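/- **Setting.** Let $k\ge 3$ and let $T$ be the $k$-regular tree. An *exhaustion* of $T$ is an increasing sequence $(V_n)$ of finite connected sets of vertices whose union contains every vertex. Let $G_n$ be the finite multigraph obtained from the subgraph of $T$ induced by $V_n$ and its neighbours by merging the neighbours outside $V_n$ into a single vertex; its edges are identified with edges of $T$, and configurations on $G_n$ are viewed as configurations $\omega\in\{0,1\}^{E(T)}$ in which all other edges are closed. For $\beta\in(0,\infty)$, the arboreal gas $\mathbb A_\beta^{G}$ on a finite multigraph $G$ is the probability measure on $\{0,1\}^{E(G)}$ giving each forest $\eta$ (a spanning subgraph without cycles) probability proportional to $\beta^{|\eta|}$, where $|\eta|$ is the number of edges of $\eta$, and giving all other configurations probability $0$; $\mathbb A_\infty^{G}$ denotes the uniform spanning tree of a finite connected multigraph $G$. For $\beta\in(0,\infty]$, the wired arboreal gas $\mathbb W_\beta^T$ is the probability measure on $\{0,1\}^{E(T)}$ that is the weak limit of $\mathbb A_\beta^{G_n}$ along every exhaustion; in particular $\mathbb W_\infty^T$ is the wired uniform spanning forest. For measures $\mu,\nu$ on $\{0,1\}^{E}$ write $\mu\lesssim\nu$ ($\mu$ is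 stochastically dominated by $\nu$) if $\mu(A)\le\nu(A)$ for every measurable event $A$ that is increasing for the coordinatewise order. **Corollary (Stochastic domination).** For every $\beta\in(0,\infty]$ the measure $\mathbb W_\beta^T$ exists and is unique, and the following hold. 1. For all $\beta_1,\beta_2\in(0,\infty]$ with $\beta_1<\beta_2$, we have $\mathbb W_{\beta_1}^T\lesssim\mathbb W_{\beta_2}^T$. 2. For every $\beta\in(0,\infty]$ and every edge $e$ of $T$, the events $\{e\in\omega\}$ and $\{e\notin\omega\}$ have positive $\mathbb W_\beta^T$-probability, and $\mathbb W_\beta^T(\,\cdot\mid e\in\omega)\lesssim\mathbb W_\beta^T(\,\cdot\mid e\notin\omega)$, where these are viewed as measures on the configurations of the edges of $T$ other than $e$. -/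

import Mathlib

open MeasureTheory ProbabilityTheory Filter Topology
open scoped ENNReal BoundedContinuousFunction

noncomputable section

namespace WiredGas

section Multigraph

variable {α E : Type*}

/-- A multigraph is acyclic if it has no cycle, where a cycle of length `n + 1` consists of distinct
vertices `v 0, …, v n` and distinct edges `e 0, …, e n` such that `e i` joins `v i` to `v (i + 1)`
(indices modulo `n + 1`). Loops (`n = 0`) and pairs of parallel edges (`n = 1`) are cycles. -/
def IsAcyclic (G : Graph α E) : Prop :=
  ∀ (n : ℕ) (v : Fin (n + 1) → α) (e : Fin (n + 1) → E),
    Function.Injective v → Function.Injective e → ¬ ∀ i, G.IsLink (e i) (v i) (v (i + 1))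

/-- Any two vertices of the multigraph are joined by a path. -/
def IsConnected (G : Graph α E) : Prop :=
  ∀ x ∈ G.vertexSet, ∀ y ∈ G.vertexSet, Relation.ReflTransGen G.Adj x y

/-- The set of open edges of a configuration in `{0, 1} ^ E(G)`. -/
def openEdges (G : Graph α E) (ω : G.edgeSet → Bool) : Set E :=
  {e | ∃ h : e ∈ G.edgeSet, ω ⟨e, h⟩ = true}

/-- The spanning subgraph of `G` given by the open edges of `ω` is a forest. -/
def IsForest (G : Graph α E) (ω : G.edgeSet → Bool) : Prop :=
  IsAcyclic (G.restrict (openEdges G ω))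

/-- The spanning subgraph of `G` given by the open edges of `ω` is a tree. -/
def IsSpanningTree (G : Graph α E) (ω : G.edgeSet → Bool) : Prop :=
  IsForest G ω ∧ IsConnected (G.restrict (openEdges G ω))

open Classical in
/-- The weight `β ^ |ω|` of a forest `ω`, and `0` for a configuration that is not a forest. -/
def forestWeight (G : Graph α E) (β : ℝ≥0∞) (ω : G.edgeSet → Bool) : ℝ≥0∞ :=
  if IsForest G ω then β ^ (openEdges G ω).ncard else 0

/-- The arboreal gas on a finite multigraph `G` at a finite parameter `β > 0`: the configuration `ω`
has probability `forestWeight G β ω / Z`, with `Z` the sum of all the weights. -/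
def arborealGas (G : Graph α E) (β : ℝ≥0∞) : Measure (G.edgeSet → Bool) :=
  (∑' ω, forestWeight G β ω)⁻¹ • Measure.sum fun ω ↦ forestWeight G β ω • Measure.dirac ω

/-- The uniform spanning tree of a finite connected multigraph `G`. -/
def uniformSpanningTree (G : Graph α E) : Measure (G.edgeSet → Bool) :=
  uniformOn {ω | IsSpanningTree G ω}

end Multigraph

section Tree

variable {V : Type*} (T : SimpleGraph V)

/-- Configurations in `{0, 1} ^ E(T)`, with the product topology, the product `σ`-algebra and the
coordinatewise order. -/
abbrev Config : Type _ := T.edgeSet → Bool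

/-- The vertices of `S` together with all their neighbours in `T`. -/
def withNeighbours (S : Set V) : Set V := S ∪ {v | ∃ u ∈ S, T.Adj u v}

open Classical in
/-- The map that fixes the vertices of `S` and merges all the others to the one vertex `none`. -/
def merge (S : Set V) (v : V) : Option V := if v ∈ S then some v else none

/-- The multigraph with wired boundary conditions given by `S`: the subgraph of `T` induced by `S`
and its neighbours, with the neighbours outside `S` merged to the single vertex `none`. Its edges are
edges of `T`. -/
def wiredGraph (S : Set V) : Graph (Option V) (Sym2 V) :=
  ((Graph.ofSimpleGraph T).induce (withNeighbours T S)).map (merge S)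

open Classical in
/-- A configuration on the edges of a wired graph, seen as a configuration on the edges of `T` in
which all the edges outside the wired graph are closed. -/
def closedExtension (S : Set V) (ω : (wiredGraph T S).edgeSet → Bool) : Config T :=
  fun e ↦ if h : (e : Sym2 V) ∈ (wiredGraph T S).edgeSet then ω ⟨e, h⟩ else false

open Classical in
/-- The arboreal gas of parameter `β` on the wired graph of `S` (the uniform spanning tree if
`β = ∞`), as a measure on configurations on the edges of `T`. -/
def finiteGas (β : ℝ≥0∞) (S : Set V) : Measure (Config T) :=
  if β = ∞ then (uniformSpanningTree (wiredGraph T S)).map (closedExtension T S)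
  else (arborealGas (wiredGraph T S) β).map (closedExtension T S)

/-- A growing sequence of finite connected sets of vertices that covers all the vertices. -/
structure IsExhaustion (S : ℕ → Finset V) : Prop where
  monotone : Monotone S
  connected : ∀ n, (T.induce (S n : Set V)).Connected
  exhausts : ∀ v, ∃ n, v ∈ S n

/-- Weak convergence of a sequence of measures. -/
def WeaklyConverges {Ω : Type*} [TopologicalSpace Ω] [MeasurableSpace Ω]
    (μs : ℕ → Measure Ω) (μ : Measure Ω) : Prop :=
  ∀ f : Ω →ᵇ ℝ, Tendsto (fun n ↦ ∫ ω, f ω ∂(μs n)) atTop (𝓝 (∫ ω, f ω ∂μ))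

/-- The measure `μ` is the wired arboreal gas of parameter `β` on `T` (the wired uniform spanning
forest if `β = ∞`): the probability measure that is the weak limit of the measures on the wired
graphs along every exhaustion. -/
structure IsWiredGas (β : ℝ≥0∞) (μ : Measure (Config T)) : Prop where
  isProbabilityMeasure : IsProbabilityMeasure μ
  tendsto : ∀ S : ℕ → Finset V, IsExhaustion T S →
    WeaklyConverges (fun n ↦ finiteGas T β (S n : Set V)) μ

/-- The restriction of a configuration to the edges other than `e`. -/
def forget (e : T.edgeSet) (ω : Config T) : {f : T.edgeSet // f ≠ e} → Bool := fun f ↦ ω f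

end Tree

/-- Stochastic domination: every increasing event is at most as likely under `μ` as under `ν`. -/
def StochasticallyDominated {Ω : Type*} [Preorder Ω] [MeasurableSpace Ω] (μ ν : Measure Ω) : Prop :=
  ∀ A : Set Ω, MeasurableSet A → IsUpperSet A → μ A ≤ ν A

end WiredGas

end

/-!
The wired graph of a finite subtree `S` is a tree whose leaves are identified, and for such graphs
the arboreal gas is a Markov field along the tree. A set of edges is a forest of the wired graph if
and only if each of its clusters in the tree meets the boundary at most once
(`isAcyclic_wiredSubgraph_iff`). Up to a constant, the weight of a forest is `t` to the power of the
number of clusters that do not meet the boundary, where `t = 1 / β`; for `t = 0` only the spanning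
trees are left, so that `β = ∞` needs no separate treatment (`wiredLaw_singleton`).

For a finite subtree `A`, let `P` be the set of those vertices of `A` that are joined to the boundary
outside `A`. The pair of the open edges inside `A` and of `P` has an explicit weight (`gibbsWeight`),
which depends on the configuration outside `A` only through one number at each vertex, the weight of
its being in `P`. Summing out a leaf changes this number at its neighbour only
(`gibbs_insert`), by the recursion `x ↦ (k - 1) x / (1 + t + (k - 1) x)` for the branches of the
`k`-regular tree. Started from the wired boundary, where `x = 1`, the iterates decrease to the
largest fixed point `branchWeight k t`, and irregular shapes of `S` are squeezed between the two
(`exists_gibbs_marginal`). Therefore the marginals converge to those of a limiting model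
(`tendsto_integral_finiteGas`), and compactness of the space of probability measures gives existence
and uniqueness of the limit.

In the limiting model, a new leaf is revealed by a Markov kernel (`limitGibbs_insert`) that is
increasing in the configuration revealed before, and whose probabilities `1 / leafWeight k t` and
`branchWeight k t` are decreasing in `t`. Monotonicity in `β` follows by induction over the leaves,
starting from a single vertex (`limitGibbs_mono`). Only the limit is compared here: the explicit form
of the fixed point makes `1 / leafWeight k t` monotone. Negative dependence follows by the same
induction, starting from a single edge `e`: if `e` is closed, then the events that its two ends
are joined to infinity are independent, and opening `e` conditions on at most one of them occurring
(`limitGibbs_negative_dependence`). Both comparisons pass from increasing events of finitely many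
edges to all measurable increasing events by `stochasticallyDominated_of_fill`.
-/

/-! ### Subtrees of a tree and their growth by leaves -/

namespace WiredGas

section Subtrees

variable {V : Type*} {T : SimpleGraph V}

open Classical in
/-- The edges of `T` with both ends in `A`. -/
noncomputable def edgesIn (T : SimpleGraph V) (A : Finset V) : Finset (Sym2 V) :=
  A.sym2.filter (· ∈ T.edgeSet)

theorem mem_edgesIn {A : Finset V} {a b : V} :
    s(a, b) ∈ edgesIn T A ↔ a ∈ A ∧ b ∈ A ∧ T.Adj a b := by
  classical
  simp [edgesIn, and_assoc]

theorem edgesIn_subset_edgeSet {A : Finset V} {e : Sym2 V} (h : e ∈ edgesIn T A) :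
    e ∈ T.edgeSet := by
  induction e with
  | h a b => exact (mem_edgesIn.1 h).2.2

theorem edgesIn_mono {A B : Finset V} (h : A ⊆ B) : edgesIn T A ⊆ edgesIn T B := by
  intro e
  induction e with
  | h a b =>
    simp only [mem_edgesIn]
    exact fun ⟨ha, hb, hab⟩ ↦ ⟨h ha, h hb, hab⟩

/-- `v ∉ A` is adjacent to `u ∈ A` and to no other vertex of `A`. -/
structure IsLeaf (T : SimpleGraph V) (A : Finset V) (u v : V) : Prop where
  mem : u ∈ A
  notMem : v ∉ A
  adj : T.Adj u v
  unique : ∀ w ∈ A, T.Adj w v → w = u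

theorem IsLeaf.ne {A : Finset V} {u v : V} (h : IsLeaf T A u v) : u ≠ v := h.adj.ne

theorem not_reflTransGen_of_isAcyclic (hT : T.IsAcyclic) {a b : V} (hab : T.Adj a b) :
    ¬ Relation.ReflTransGen (fun x y ↦ s(x, y) ∈ T.edgeSet ∧ s(x, y) ≠ s(a, b)) a b := by
  have := SimpleGraph.isAcyclic_iff_forall_adj_isBridge.1 hT hab
  rw [SimpleGraph.isBridge_iff, SimpleGraph.reachable_iff_reflTransGen] at this
  refine fun h ↦ this (Relation.ReflTransGen.mono (fun x y hxy ↦ ?_) _ _ h)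
  simpa [SimpleGraph.deleteEdges_adj] using hxy

/-- In a tree, a vertex outside a connected set has at most one neighbour in it. -/
theorem isLeaf_of_connected (hT : T.IsAcyclic) {A : Finset V}
    (hA : (T.induce (A : Set V)).Connected) {u v : V} (hu : u ∈ A) (hv : v ∉ A)
    (huv : T.Adj u v) : IsLeaf T A u v := by
  refine ⟨hu, hv, huv, fun w hw hwv ↦ ?_⟩
  by_contra hne
  refine not_reflTransGen_of_isAcyclic hT huv ?_
  have h1 : Relation.ReflTransGen (T.induce (A : Set V)).Adj ⟨u, hu⟩ ⟨w, hw⟩ :=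
    (SimpleGraph.reachable_iff_reflTransGen _ _).1 (hA.preconnected _ _)
  have h2 : Relation.ReflTransGen (fun x y ↦ s(x, y) ∈ T.edgeSet ∧ s(x, y) ≠ s(u, v)) u w := by
    refine Relation.ReflTransGen.lift (fun x : (A : Set V) ↦ (x : V)) ?_ _ _ h1
    rintro ⟨a, ha⟩ ⟨b, hb⟩ hab
    refine ⟨hab, fun h ↦ ?_⟩
    have : v ∈ s(a, b) := by simp [h]
    rcases Sym2.mem_iff.1 this with rfl | rfl
    exacts [hv ha, hv hb]
  refine h2.tail ⟨hwv, fun h ↦ hne ?_⟩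
  simpa [huv.ne'] using h

theorem IsLeaf.connected_insert [DecidableEq V] {A : Finset V} {u v : V} (h : IsLeaf T A u v)
    (hA : (T.induce (A : Set V)).Connected) :
    (T.induce ((insert v A : Finset V) : Set V)).Connected := by
  have := SimpleGraph.connected_induce_union (G := T) (s := (A : Set V)) (t := {v})
    hA.preconnected SimpleGraph.Preconnected.of_subsingleton h.mem rfl h.adj
  rwa [Finset.coe_insert, Set.insert_eq, Set.union_comm]

theorem IsLeaf.edgesIn_insert [DecidableEq V] {A : Finset V} {u v : V} (h : IsLeaf T A u v) :
    edgesIn T (insert v A) = insert s(u, v) (edgesIn T A) := by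
  ext e
  induction e with
  | h a b =>
    simp only [Finset.mem_insert, mem_edgesIn]
    constructor
    · rintro ⟨rfl | ha, rfl | hb, hab⟩
      · exact (hab.ne rfl).elim
      · rw [h.unique b hb hab.symm, Sym2.eq_swap]; simp
      · rw [h.unique a ha hab]; simp
      · exact Or.inr ⟨ha, hb, hab⟩
    · rintro (h' | h')
      · rcases Sym2.eq_iff.1 h' with ⟨rfl, rfl⟩ | ⟨rfl, rfl⟩
        · exact ⟨Or.inr h.mem, Or.inl rfl, h.adj⟩
        · exact ⟨Or.inl rfl, Or.inr h.mem, h.adj.symm⟩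
      · exact ⟨Or.inr h'.1, Or.inr h'.2.1, h'.2.2⟩

theorem IsLeaf.edge_notMem {A : Finset V} {u v : V} (h : IsLeaf T A u v) :
    s(u, v) ∉ edgesIn T A := fun h' ↦ h.notMem (mem_edgesIn.1 h').2.1

/-- `Grow T A B`: the set `B` is obtained from `A` by adding leaves one at a time. -/
inductive Grow [DecidableEq V] (T : SimpleGraph V) (A : Finset V) : Finset V → Prop
  | refl : Grow T A A
  | step {B : Finset V} {u v : V} : Grow T A B → IsLeaf T B u v → Grow T A (insert v B)

variable [DecidableEq V]

theorem Grow.subset {A B : Finset V} (h : Grow T A B) : A ⊆ B := by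
  induction h with
  | refl => exact subset_rfl
  | step _ _ ih => exact ih.trans (Finset.subset_insert _ _)

theorem Grow.connected {A B : Finset V} (h : Grow T A B)
    (hA : (T.induce (A : Set V)).Connected) : (T.induce (B : Set V)).Connected := by
  induction h with
  | refl => exact hA
  | step _ hl ih => exact hl.connected_insert ih

theorem Grow.trans {A B C : Finset V} (h : Grow T A B) (h' : Grow T B C) : Grow T A C := by
  induction h' with
  | refl => exact h
  | step _ hl ih => exact ih.step hl

/-- A connected set of vertices of a tree grows by leaves out of any connected subset. -/
theorem grow_of_connected (hT : T.IsAcyclic) {A B : Finset V} (hAB : A ⊆ B)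
    (hA : (T.induce (A : Set V)).Connected) (hB : (T.induce (B : Set V)).Connected) :
    Grow T A B := by
  induction hn : (B \ A).card generalizing A with
  | zero =>
    have : B ⊆ A := by simpa [Finset.sdiff_eq_empty_iff_subset] using hn
    rw [Finset.Subset.antisymm hAB this]
    exact .refl
  | succ n ih =>
    obtain ⟨v, hv⟩ : (B \ A).Nonempty := Finset.card_pos.1 (by omega)
    obtain ⟨⟨a, ha⟩⟩ := hA.nonempty
    have hr : Relation.ReflTransGen (T.induce (B : Set V)).Adj ⟨a, hAB ha⟩
        ⟨v, (Finset.mem_sdiff.1 hv).1⟩ :=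
      (SimpleGraph.reachable_iff_reflTransGen _ _).1 (hB.preconnected _ _)
    -- the path leaves `A` through some edge
    obtain ⟨x, y, hx, hy, hyB, hxy⟩ : ∃ x y, x ∈ A ∧ y ∉ A ∧ y ∈ B ∧ T.Adj x y := by
      by_contra! hcon
      have key : ∀ z : (B : Set V), Relation.ReflTransGen (T.induce (B : Set V)).Adj
          ⟨a, hAB ha⟩ z → (z : V) ∈ A := by
        intro z hz
        induction hz with
        | refl => exact ha
        | @tail b c _ hbc ih' =>
          by_contra hc
          exact hcon b c ih' hc c.2 hbc
      exact (Finset.mem_sdiff.1 hv).2 (key _ hr)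
    have hl := isLeaf_of_connected hT hA hx hy hxy
    refine (Grow.refl.step hl).trans (ih ?_ (hl.connected_insert hA) ?_)
    · exact Finset.insert_subset hyB hAB
    · rw [Finset.sdiff_insert, Finset.card_erase_of_mem (Finset.mem_sdiff.2 ⟨hyB, hy⟩), hn]
      rfl

omit [DecidableEq V] in
theorem connected_singleton (o : V) : (T.induce (({o} : Finset V) : Set V)).Connected := by
  simpa using ⟨SimpleGraph.Preconnected.of_subsingleton⟩

theorem connected_pair {x y : V} (h : T.Adj x y) :
    (T.induce (({x, y} : Finset V) : Set V)).Connected := by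
  rw [Finset.coe_pair]
  exact SimpleGraph.induce_pair_connected_of_adj h

end Subtrees

/-! ### Connection by open edges -/

section Reach

variable {V : Type*} {T : SimpleGraph V}

/-- `x` and `y` are joined by a path of edges in `F`. -/
def Reach (F : Finset (Sym2 V)) (x y : V) : Prop :=
  Relation.ReflTransGen (fun a b ↦ s(a, b) ∈ F) x y

theorem Reach.symm {F : Finset (Sym2 V)} {x y : V} (h : Reach F x y) : Reach F y x := by
  have : Std.Symm (fun a b ↦ s(a, b) ∈ F) := ⟨fun a b h ↦ by rwa [Sym2.eq_swap]⟩
  exact Relation.ReflTransGen.stdSymm.symm _ _ h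

theorem Reach.trans {F : Finset (Sym2 V)} {x y z : V} (h : Reach F x y) (h' : Reach F y z) :
    Reach F x z := Relation.ReflTransGen.trans h h'

theorem Reach.mono {F F' : Finset (Sym2 V)} (hF : F ⊆ F') {x y : V} (h : Reach F x y) :
    Reach F' x y := Relation.ReflTransGen.mono (fun _ _ h ↦ hF h) _ _ h

theorem Reach.mem {A : Finset V} {F : Finset (Sym2 V)} (hF : F ⊆ edgesIn T A) {x y : V}
    (h : Reach F x y) (hx : x ∈ A) : y ∈ A := by
  induction h with
  | refl => exact hx
  | tail _ h _ => exact (mem_edgesIn.1 (hF h)).2.1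

theorem Reach.eq_of_notMem {A : Finset V} {F : Finset (Sym2 V)} (hF : F ⊆ edgesIn T A) {x y : V}
    (h : Reach F x y) (hx : x ∉ A) : y = x := by
  induction h with
  | refl => rfl
  | tail _ h ih => subst ih; exact (hx (mem_edgesIn.1 (hF h)).1).elim

/-- Distinct points of `P` lie in distinct clusters of `F`. -/
def Separated (F : Finset (Sym2 V)) (P : Finset V) : Prop :=
  ∀ p ∈ P, ∀ q ∈ P, Reach F p q → p = q

variable [DecidableEq V] {A : Finset V} {u v : V} {F : Finset (Sym2 V)} {P : Finset V}

/-- Contracting the edge to a leaf `v` at `u` does not change which vertices are connected. -/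
theorem IsLeaf.reach_insert_edge (h : IsLeaf T A u v) (hF : F ⊆ edgesIn T A) {x y : V} :
    Reach (insert s(u, v) F) x y ↔ Reach F (if x = v then u else x) (if y = v then u else y) := by
  constructor
  · refine Relation.ReflTransGen.lift' (fun z ↦ if z = v then u else z) (fun a b hab ↦ ?_) x y
    change Reach F (if a = v then u else a) (if b = v then u else b)
    rcases Finset.mem_insert.1 hab with hab | hab
    · rcases Sym2.eq_iff.1 hab with ⟨rfl, rfl⟩ | ⟨rfl, rfl⟩ <;> simp [Reach, Relation.ReflTransGen.refl]
    · have ha : a ≠ v := fun h' ↦ h.notMem (h' ▸ (mem_edgesIn.1 (hF hab)).1)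
      have hb : b ≠ v := fun h' ↦ h.notMem (h' ▸ (mem_edgesIn.1 (hF hab)).2.1)
      rw [if_neg ha, if_neg hb]
      exact .single hab
  · have key : ∀ z, Reach (insert s(u, v) F) z (if z = v then u else z) := by
      intro z
      split_ifs with hz
      · subst hz
        exact .single (by rw [Sym2.eq_swap]; simp)
      · exact .refl
    exact fun h' ↦ ((key x).trans (h'.mono (Finset.subset_insert _ _))).trans (key y).symm

theorem IsLeaf.separated_insert_vertex (h : IsLeaf T A u v) (hF : F ⊆ edgesIn T A) (hP : P ⊆ A) :
    Separated F (insert v P) ↔ Separated F P := by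
  refine ⟨fun H p hp q hq ↦ H p (Finset.mem_insert_of_mem hp) q (Finset.mem_insert_of_mem hq),
    fun H p hp q hq hpq ↦ ?_⟩
  rcases Finset.mem_insert.1 hp with rfl | hp'
  · exact (hpq.eq_of_notMem hF h.notMem).symm
  · rcases Finset.mem_insert.1 hq with rfl | hq'
    · exact (h.notMem (hpq.mem hF (hP hp'))).elim
    · exact H p hp' q hq' hpq

theorem IsLeaf.separated_insert_edge (h : IsLeaf T A u v) (hF : F ⊆ edgesIn T A) (hP : P ⊆ A) :
    Separated (insert s(u, v) F) P ↔ Separated F P := by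
  have hne : ∀ p ∈ P, p ≠ v := fun p hp h' ↦ h.notMem (h' ▸ hP hp)
  unfold Separated
  refine forall₂_congr fun p hp ↦ forall₂_congr fun q hq ↦ ?_
  rw [h.reach_insert_edge hF, if_neg (hne p hp), if_neg (hne q hq)]

theorem IsLeaf.separated_insert_insert (h : IsLeaf T A u v) (hF : F ⊆ edgesIn T A) (hP : P ⊆ A)
    (hu : u ∉ P) :
    Separated (insert s(u, v) F) (insert v P) ↔ Separated F (insert u P) := by
  have hne : ∀ p ∈ P, p ≠ v := fun p hp h' ↦ h.notMem (h' ▸ hP hp)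
  have hne' : ∀ p ∈ P, p ≠ u := fun p hp h' ↦ hu (h' ▸ hp)
  simp only [Separated, Finset.forall_mem_insert, h.reach_insert_edge hF, if_true]
  refine and_congr (and_congr (by simp) (forall₂_congr fun q hq ↦ ?_))
    (forall₂_congr fun p hp ↦ and_congr ?_ (forall₂_congr fun q hq ↦ ?_))
  · simp [hne q hq, (hne q hq).symm, (hne' q hq).symm]
  · simp [hne p hp, hne' p hp]
  · simp [hne p hp, hne q hq]

theorem IsLeaf.not_separated_insert_insert (h : IsLeaf T A u v) (hu : u ∈ P) :
    ¬ Separated (insert s(u, v) F) (insert v P) := fun H ↦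
  h.ne (H u (Finset.mem_insert_of_mem hu) v (Finset.mem_insert_self _ _)
    (.single (Finset.mem_insert_self _ _)))

/-- The number of clusters of `F` that miss `P` is `|A| - |F| - |P|`; in particular it is
nonnegative, and it is `0` if and only if all vertices are connected to `P`. -/
theorem Separated.card_le {o : V} (hA : Grow T {o} A) (hF : F ⊆ edgesIn T A) (hP : P ⊆ A)
    (hs : Separated F P) :
    F.card + P.card ≤ A.card ∧
      (F.card + P.card = A.card ↔ ∀ a ∈ A, ∃ p ∈ P, Reach F a p) := by
  induction hA generalizing F P with
  | refl =>
    have hF' : F = ∅ := by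
      refine Finset.eq_empty_of_forall_notMem fun e he ↦ ?_
      have := hF he
      induction e with
      | h a b =>
        rw [mem_edgesIn] at this
        simp only [Finset.mem_singleton] at this
        exact this.2.2.ne (this.1.trans this.2.1.symm)
    subst hF'
    rcases Finset.subset_singleton_iff.1 hP with rfl | rfl
    · simp
    · simpa using .refl
  | @step B u v hB hl ih =>
    rw [hl.edgesIn_insert] at hF
    have hv := hl.notMem
    have hcard : (insert v B).card = B.card + 1 := Finset.card_insert_of_notMem hv
    -- split off the new edge and the new vertex
    obtain ⟨F', hF', hFF⟩ : ∃ F' ⊆ edgesIn T B, F = F' ∨ F = insert s(u, v) F' := by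
      refine ⟨F.erase s(u, v), ?_, ?_⟩
      · rwa [Finset.subset_insert_iff] at hF
      · by_cases h : s(u, v) ∈ F
        · right; rw [Finset.insert_erase h]
        · left; rw [Finset.erase_eq_of_notMem h]
    obtain ⟨P', hP', hPP⟩ : ∃ P' ⊆ B, P = P' ∨ P = insert v P' := by
      refine ⟨P.erase v, ?_, ?_⟩
      · rwa [Finset.subset_insert_iff] at hP
      · by_cases h : v ∈ P
        · right; rw [Finset.insert_erase h]
        · left; rw [Finset.erase_eq_of_notMem h]
    have hvP : v ∉ P' := fun h ↦ hv (hP' h)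
    have heF : s(u, v) ∉ F' := fun h ↦ hl.edge_notMem (hF' h)
    have hneB : ∀ a ∈ B, a ≠ v := fun a ha h ↦ hv (h ▸ ha)
    rcases hFF with rfl | rfl <;> rcases hPP with rfl | rfl
    · obtain ⟨h1, -⟩ := ih hF' hP' hs
      refine ⟨by omega, iff_of_false (by omega) fun H ↦ ?_⟩
      obtain ⟨p, hp, hr⟩ := H v (Finset.mem_insert_self _ _)
      exact hvP (hr.eq_of_notMem hF' hv ▸ hp)
    · obtain ⟨h1, h2⟩ := ih hF' hP' ((hl.separated_insert_vertex hF' hP').1 hs)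
      rw [Finset.card_insert_of_notMem hvP, hcard]
      refine ⟨by omega, ?_⟩
      rw [← add_assoc, add_left_inj, h2, Finset.forall_mem_insert]
      refine ⟨fun H ↦ ⟨⟨v, Finset.mem_insert_self _ _, .refl⟩, fun a ha ↦ ?_⟩, fun H a ha ↦ ?_⟩
      · obtain ⟨p, hp, hr⟩ := H a ha
        exact ⟨p, Finset.mem_insert_of_mem hp, hr⟩
      · obtain ⟨p, hp, hr⟩ := H.2 a ha
        rcases Finset.mem_insert.1 hp with rfl | hp
        · exact (hv (hr.mem hF' ha)).elim
        · exact ⟨p, hp, hr⟩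
    · obtain ⟨h1, h2⟩ := ih hF' hP' ((hl.separated_insert_edge hF' hP').1 hs)
      rw [Finset.card_insert_of_notMem heF, hcard]
      refine ⟨by omega, ?_⟩
      rw [show F'.card + 1 + P.card = (F'.card + P.card) + 1 by omega, add_left_inj, h2,
        Finset.forall_mem_insert]
      have hPne : ∀ p ∈ P, p ≠ v := fun p hp h ↦ hvP (h ▸ hp)
      refine ⟨fun H ↦ ⟨?_, fun a ha ↦ ?_⟩, fun H a ha ↦ ?_⟩
      · obtain ⟨p, hp, hr⟩ := H u hl.mem
        refine ⟨p, hp, ?_⟩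
        rw [hl.reach_insert_edge hF', if_pos rfl, if_neg (hPne p hp)]
        exact hr
      · obtain ⟨p, hp, hr⟩ := H a ha
        exact ⟨p, hp, hr.mono (Finset.subset_insert _ _)⟩
      · obtain ⟨p, hp, hr⟩ := H.2 a ha
        rw [hl.reach_insert_edge hF', if_neg (hneB a ha), if_neg (hPne p hp)] at hr
        exact ⟨p, hp, hr⟩
    · have hu : u ∉ P' := fun h ↦ hl.not_separated_insert_insert h hs
      obtain ⟨h1, h2⟩ := ih hF' (Finset.insert_subset hl.mem hP')
        ((hl.separated_insert_insert hF' hP' hu).1 hs)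
      rw [Finset.card_insert_of_notMem hu] at h1 h2
      rw [Finset.card_insert_of_notMem heF, Finset.card_insert_of_notMem hvP, hcard]
      refine ⟨by omega, ?_⟩
      rw [show F'.card + 1 + (P'.card + 1) = (F'.card + (P'.card + 1)) + 1 by omega,
        add_left_inj, h2, Finset.forall_mem_insert]
      refine ⟨fun H ↦ ⟨⟨v, Finset.mem_insert_self _ _, .refl⟩, fun a ha ↦ ?_⟩, fun H a ha ↦ ?_⟩
      · obtain ⟨p, hp, hr⟩ := H a ha
        rcases Finset.mem_insert.1 hp with rfl | hp
        · exact ⟨v, Finset.mem_insert_self _ _, (hl.reach_insert_edge hF').2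
            (by simpa [hneB a ha] using hr)⟩
        · exact ⟨p, Finset.mem_insert_of_mem hp, hr.mono (Finset.subset_insert _ _)⟩
      · obtain ⟨p, hp, hr⟩ := H.2 a ha
        rw [hl.reach_insert_edge hF', if_neg (hneB a ha)] at hr
        rcases Finset.mem_insert.1 hp with rfl | hp
        · exact ⟨u, Finset.mem_insert_self _ _, by simpa using hr⟩
        · exact ⟨p, Finset.mem_insert_of_mem hp, by
            simpa [show p ≠ v from fun h ↦ hvP (h ▸ hp)] using hr⟩

end Reach

/-! ### Gibbs sums on subtrees and the removal of a leaf -/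

section Gibbs

variable {V : Type*} [DecidableEq V] {T : SimpleGraph V} {t : ℝ} {a b : V → ℝ} {A : Finset V}
  {u v o : V}

open Classical in
/-- The weight of a forest `F` on `A` together with the set `P` of those vertices of `A` that are
joined to infinity (or to the boundary) outside `A`. Every cluster may contain at most one vertex of
`P`, and each of the `|A| - |F| - |P|` clusters without such a vertex has weight `t = 1 / β`. The
branches outside `A` at a vertex `v` have total weight `b v` if `v ∈ P` and `a v` otherwise. -/
noncomputable def gibbsWeight (t : ℝ) (a b : V → ℝ) (A : Finset V) (F : Finset (Sym2 V))
    (P : Finset V) : ℝ :=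
  if Separated F P then
    t ^ (A.card - F.card - P.card) * ∏ v ∈ A, (if v ∈ P then b v else a v) else 0

/-- The sum of `f` against `gibbsWeight`. -/
noncomputable def gibbs (T : SimpleGraph V) (t : ℝ) (a b : V → ℝ) (A : Finset V)
    (f : Finset (Sym2 V) → Finset V → ℝ) : ℝ :=
  ∑ F ∈ (edgesIn T A).powerset, ∑ P ∈ A.powerset, gibbsWeight t a b A F P * f F P

theorem gibbs_congr {f g : Finset (Sym2 V) → Finset V → ℝ}
    (h : ∀ F ⊆ edgesIn T A, ∀ P ⊆ A, f F P = g F P) :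
    gibbs T t a b A f = gibbs T t a b A g :=
  Finset.sum_congr rfl fun F hF ↦ Finset.sum_congr rfl fun P hP ↦ by
    rw [h F (Finset.mem_powerset.1 hF) P (Finset.mem_powerset.1 hP)]

theorem gibbs_const_mul (c : ℝ) (f : Finset (Sym2 V) → Finset V → ℝ) :
    gibbs T t a b A (fun F P ↦ c * f F P) = c * gibbs T t a b A f := by
  simp only [gibbs, Finset.mul_sum]
  exact Finset.sum_congr rfl fun F _ ↦ Finset.sum_congr rfl fun P _ ↦ by ring

theorem gibbsWeight_nonneg (ht : 0 ≤ t) (ha : ∀ v ∈ A, 0 ≤ a v) (hb : ∀ v ∈ A, 0 ≤ b v)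
    (F : Finset (Sym2 V)) (P : Finset V) : 0 ≤ gibbsWeight t a b A F P := by
  unfold gibbsWeight
  split_ifs
  · refine mul_nonneg (pow_nonneg ht _) (Finset.prod_nonneg fun v hv ↦ ?_)
    split_ifs
    exacts [hb v hv, ha v hv]
  · exact le_rfl

theorem gibbs_le_gibbs (ht : 0 ≤ t) (ha : ∀ v ∈ A, 0 ≤ a v) (hb : ∀ v ∈ A, 0 ≤ b v)
    {f g : Finset (Sym2 V) → Finset V → ℝ} (h : ∀ F P, f F P ≤ g F P) :
    gibbs T t a b A f ≤ gibbs T t a b A g :=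
  Finset.sum_le_sum fun F _ ↦ Finset.sum_le_sum fun P _ ↦
    mul_le_mul_of_nonneg_left (h F P) (gibbsWeight_nonneg ht ha hb F P)

/-- The sum over the states of a leaf `v` at `u` and of its edge. If `u ∈ P`, then `u` is joined to
infinity either through `v` or by a branch that does not contain `v`. -/
noncomputable def peel (t : ℝ) (a b : V → ℝ) (u v : V) (f : Finset (Sym2 V) → Finset V → ℝ)
    (F : Finset (Sym2 V)) (P : Finset V) : ℝ :=
  if u ∈ P then
    a u * b v * f (insert s(u, v) F) (insert v (P.erase u)) +
      b u * (t * a v * f F P + b v * f F (insert v P) + a v * f (insert s(u, v) F) P)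
  else
    a u * (t * a v * f F P + b v * f F (insert v P) + a v * f (insert s(u, v) F) P)

/-- Summing out a leaf `v` at `u` moves the weights of `v` into the weights of `u`. -/
theorem gibbs_insert (hA : Grow T {o} A) (hl : IsLeaf T A u v)
    (f : Finset (Sym2 V) → Finset V → ℝ) :
    gibbs T t a b (insert v A) f =
      gibbs T t (Function.update a u 1) (Function.update b u 1) A (peel t a b u v f) := by
  have hv := hl.notMem
  have hcard : (insert v A).card = A.card + 1 := Finset.card_insert_of_notMem hv
  unfold gibbs
  rw [hl.edgesIn_insert, Finset.sum_powerset_insert hl.edge_notMem, ← Finset.sum_add_distrib]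
  refine Finset.sum_congr rfl fun F hF ↦ ?_
  replace hF := Finset.mem_powerset.1 hF
  have heF : s(u, v) ∉ F := fun h ↦ hl.edge_notMem (hF h)
  have heFc : (insert s(u, v) F).card = F.card + 1 := Finset.card_insert_of_notMem heF
  rw [Finset.sum_powerset_insert hv, Finset.sum_powerset_insert hv]
  simp only [← Finset.sum_add_distrib]
  have huA : u ∉ A.erase u := Finset.notMem_erase u A
  rw [← Finset.insert_erase hl.mem, Finset.sum_powerset_insert huA, Finset.sum_powerset_insert huA,
    ← Finset.sum_add_distrib, ← Finset.sum_add_distrib, Finset.insert_erase hl.mem]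
  refine Finset.sum_congr rfl fun P hP ↦ ?_
  replace hP := Finset.mem_powerset.1 hP
  have huP : u ∉ P := fun h ↦ huA (hP h)
  have hPA : P ⊆ A := hP.trans (Finset.erase_subset _ _)
  have hvP : v ∉ P := fun h ↦ hv (hPA h)
  have hune := hl.ne
  have huPc : (insert u P).card = P.card + 1 := Finset.card_insert_of_notMem huP
  have hvPc : (insert v P).card = P.card + 1 := Finset.card_insert_of_notMem hvP
  have hvuP : v ∉ insert u P := by simp [hune.symm, hvP]
  have hvuPc : (insert v (insert u P)).card = P.card + 2 := by
    rw [Finset.card_insert_of_notMem hvuP, huPc]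
  have huPA : insert u P ⊆ A := Finset.insert_subset hl.mem hPA
  set c : ℝ := ∏ w ∈ A.erase u, (if w ∈ P then b w else a w) with hc
  -- the product of the vertex weights, for each state of `u` and `v`
  have hprod : ∀ Q : Finset V, ∀ a' b' : V → ℝ, (∀ w ∈ A.erase u, (w ∈ Q ↔ w ∈ P)) →
      (∀ w ∈ A.erase u, a' w = a w ∧ b' w = b w) →
      ∏ w ∈ A, (if w ∈ Q then b' w else a' w) = (if u ∈ Q then b' u else a' u) * c := by
    intro Q a' b' hQ hab
    rw [← Finset.mul_prod_erase A _ hl.mem, hc]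
    congr 1
    refine Finset.prod_congr rfl fun w hw ↦ ?_
    rw [(hab w hw).1, (hab w hw).2]
    simp only [hQ w hw]
  have hprod' : ∀ Q : Finset V, (∀ w ∈ A.erase u, (w ∈ Q ↔ w ∈ P)) →
      ∏ w ∈ insert v A, (if w ∈ Q then b w else a w) =
        (if v ∈ Q then b v else a v) * ((if u ∈ Q then b u else a u) * c) := by
    intro Q hQ
    rw [Finset.prod_insert hv, hprod Q a b hQ fun _ _ ↦ ⟨rfl, rfl⟩]
  have hwu : ∀ w ∈ A.erase u, w ≠ u := fun w hw ↦ Finset.ne_of_mem_erase hw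
  have hwv : ∀ w ∈ A.erase u, w ≠ v := fun w hw h ↦ hv (h ▸ Finset.mem_of_mem_erase hw)
  have e1 := hprod' P fun _ _ ↦ Iff.rfl
  have e2 := hprod' (insert v P) fun w hw ↦ by simp [hwv w hw]
  have e3 := hprod' (insert u P) fun w hw ↦ by simp [hwu w hw]
  have e4 := hprod' (insert v (insert u P)) fun w hw ↦ by simp [hwv w hw, hwu w hw]
  have e5 := hprod P (Function.update a u 1) (Function.update b u 1) (fun _ _ ↦ Iff.rfl)
    fun w hw ↦ by simp [hwu w hw]
  have e6 := hprod (insert u P) (Function.update a u 1) (Function.update b u 1)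
    (fun w hw ↦ by simp [hwu w hw]) fun w hw ↦ by simp [hwu w hw]
  simp only [huP, hvP, hune, hune.symm, Finset.mem_insert, or_true, or_false,
    if_true, if_false, Function.update_self] at e1 e2 e3 e4 e5 e6
  have s1 := hl.separated_insert_vertex hF hPA
  have s2 := hl.separated_insert_vertex hF huPA
  have s3 := hl.separated_insert_edge hF hPA
  have s4 := hl.separated_insert_edge hF huPA
  have s5 := hl.separated_insert_insert hF hPA huP
  have s6 : ¬ Separated (insert s(u, v) F) (insert v (insert u P)) :=
    hl.not_separated_insert_insert (Finset.mem_insert_self _ _)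
  have herase : (insert u P).erase u = P := Finset.erase_insert huP
  simp only [gibbsWeight, peel, e1, e2, e3, e4, e5, e6, s6, if_false, huP,
    Finset.mem_insert, true_or, if_true, herase, hcard, heFc, huPc, hvPc, hvuPc]
  by_cases hs : Separated F P
  · have hle := (hs.card_le hA hF hPA).1
    have p1 : A.card + 1 - F.card - P.card = (A.card - F.card - P.card) + 1 := by omega
    have p2 : A.card + 1 - F.card - (P.card + 1) = A.card - F.card - P.card := by omega
    have p3 : A.card + 1 - (F.card + 1) - P.card = A.card - F.card - P.card := by omega
    by_cases hs' : Separated F (insert u P)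
    · have hle' := (hs'.card_le hA hF huPA).1
      rw [huPc] at hle'
      have p4 : A.card - F.card - P.card = (A.card - F.card - (P.card + 1)) + 1 := by omega
      have p5 : A.card + 1 - F.card - (P.card + 2) = A.card - F.card - (P.card + 1) := by omega
      have p6 : A.card + 1 - (F.card + 1) - (P.card + 1) = A.card - F.card - (P.card + 1) := by
        omega
      simp only [s1.2 hs, s2.2 hs', s3.2 hs, s4.2 hs', s5.2 hs', hs, hs', if_true, p1, p2, p3, p5, p6]
      rw [p4, pow_succ, pow_succ]
      ring
    · simp only [s1.2 hs, mt s2.1 hs', s3.2 hs, mt s4.1 hs', mt s5.1 hs', hs, hs', if_true, if_false,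
        p1, p2, p3, pow_succ]
      ring
  · have hs' : ¬ Separated F (insert u P) := fun H ↦ hs fun p hp q hq ↦
      H p (Finset.mem_insert_of_mem hp) q (Finset.mem_insert_of_mem hq)
    simp only [mt s1.1 hs, mt s2.1 hs', mt s3.1 hs, mt s4.1 hs', mt s5.1 hs', hs, hs', if_false,
      zero_mul, add_zero]

/-- Weights at the vertex `u` can be moved into the summand. -/
theorem gibbs_update (hu : u ∈ A) (x y : ℝ) (f : Finset (Sym2 V) → Finset V → ℝ) :
    gibbs T t (Function.update a u x) (Function.update b u y) A f =
      gibbs T t (Function.update a u 1) (Function.update b u 1) A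
        (fun F P ↦ (if u ∈ P then y else x) * f F P) := by
  unfold gibbs
  refine Finset.sum_congr rfl fun F _ ↦ Finset.sum_congr rfl fun P _ ↦ ?_
  unfold gibbsWeight
  have key : ∀ x y : ℝ, ∏ w ∈ A, (if w ∈ P then Function.update b u y w
      else Function.update a u x w) =
      (if u ∈ P then y else x) * ∏ w ∈ A.erase u, (if w ∈ P then b w else a w) := by
    intro x y
    rw [← Finset.mul_prod_erase A _ hu]
    simp only [Function.update_self]
    congr 1
    refine Finset.prod_congr rfl fun w hw ↦ ?_
    simp [Finset.ne_of_mem_erase hw]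
  rw [key x y, key 1 1]
  by_cases hs : Separated F P <;> by_cases hu : u ∈ P <;> simp only [hs, hu, if_true, if_false] <;>
    ring

/-- Summing out a leaf, for a function of the edges of `A` only. -/
theorem gibbs_insert_of_edges (hA : Grow T {o} A) (hl : IsLeaf T A u v)
    (g : Finset (Sym2 V) → ℝ) :
    gibbs T t a b (insert v A) (fun F _ ↦ g (F ∩ edgesIn T A)) =
      gibbs T t (Function.update a u (a u * ((1 + t) * a v + b v)))
        (Function.update b u (b u * ((1 + t) * a v + b v) + a u * b v)) A
        (fun F _ ↦ g (F ∩ edgesIn T A)) := by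
  rw [gibbs_insert hA hl, gibbs_update hl.mem (a u * _) (_ + _)]
  refine gibbs_congr fun F hF P hP ↦ ?_
  have : insert s(u, v) F ∩ edgesIn T A = F ∩ edgesIn T A :=
    Finset.insert_inter_of_notMem hl.edge_notMem
  by_cases hu : u ∈ P <;> simp only [peel, this, hu, if_true, if_false] <;> ring

omit [DecidableEq V] in
theorem edgesIn_singleton : edgesIn T {o} = ∅ := by
  refine Finset.eq_empty_of_forall_notMem fun e he ↦ ?_
  induction e with
  | h a b =>
    rw [mem_edgesIn] at he
    simp only [Finset.mem_singleton] at he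
    exact he.2.2.ne (he.1.trans he.2.1.symm)

theorem gibbs_singleton (f : Finset (Sym2 V) → Finset V → ℝ) :
    gibbs T t a b {o} f = t * a o * f ∅ ∅ + b o * f ∅ {o} := by
  have h1 : Separated (∅ : Finset (Sym2 V)) {o} := by simp [Separated]
  have h2 : Separated (∅ : Finset (Sym2 V)) (∅ : Finset V) := by simp [Separated]
  have := Finset.sum_powerset_insert (Finset.notMem_empty o)
    (fun P ↦ gibbsWeight t a b {o} ∅ P * f ∅ P)
  simp only [insert_empty_eq, Finset.powerset_empty, Finset.sum_singleton] at this
  rw [gibbs, edgesIn_singleton, Finset.powerset_empty, Finset.sum_singleton, this]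
  simp [gibbsWeight, h1, h2]

end Gibbs

/-! ### The model with the limiting boundary weights -/

section Parameters

/-- The largest fixed point in `[0, 1]` of `x ↦ (k - 1) x / (1 + t + (k - 1) x)`: the limiting
effective weight of a branch of the `k`-regular tree, seen through the edge at its root. -/
noncomputable def branchWeight (k : ℕ) (t : ℝ) : ℝ := max 0 ((k - 2 - t) / (k - 1))

/-- The total weight of the states of a new leaf and its edge, when the leaf carries `k - 1` further
branches. -/
noncomputable def leafWeight (k : ℕ) (t : ℝ) : ℝ := 1 + t + (k - 1) * branchWeight k t

variable {k : ℕ} {t t' : ℝ}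

theorem branchWeight_nonneg : 0 ≤ branchWeight k t := le_max_left _ _

theorem branchWeight_le_one (hk : 3 ≤ k) (ht : 0 ≤ t) : branchWeight k t ≤ 1 := by
  have hk' : (3 : ℝ) ≤ k := by exact_mod_cast hk
  refine max_le zero_le_one ?_
  rw [div_le_one (by linarith)]
  linarith

theorem branchWeight_anti (hk : 3 ≤ k) (h : t ≤ t') : branchWeight k t' ≤ branchWeight k t := by
  have hk' : (3 : ℝ) ≤ k := by exact_mod_cast hk
  exact max_le_max le_rfl (div_le_div_of_nonneg_right (by linarith) (by linarith))

theorem leafWeight_eq (hk : 3 ≤ k) : leafWeight k t = max (1 + t) (k - 1) := by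
  have hk' : (3 : ℝ) ≤ k := by exact_mod_cast hk
  have h1 : (0 : ℝ) < k - 1 := by linarith
  unfold leafWeight branchWeight
  rw [mul_max_of_nonneg _ _ h1.le, mul_div_cancel₀ _ h1.ne', ← max_add_add_left]
  congr 1 <;> ring

theorem leafWeight_mono (hk : 3 ≤ k) (h : t ≤ t') : leafWeight k t ≤ leafWeight k t' := by
  rw [leafWeight_eq hk, leafWeight_eq hk]
  exact max_le_max (by linarith) le_rfl

theorem one_le_leafWeight (hk : 3 ≤ k) : 1 ≤ leafWeight k t := by
  have hk' : (3 : ℝ) ≤ k := by exact_mod_cast hk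
  rw [leafWeight_eq hk]
  exact le_max_of_le_right (by linarith)

/-- The fixed-point equation of `branchWeight`. -/
theorem leafWeight_mul_branchWeight (hk : 3 ≤ k) :
    leafWeight k t * branchWeight k t = (k - 1) * branchWeight k t := by
  have hk' : (3 : ℝ) ≤ k := by exact_mod_cast hk
  have h1 : (0 : ℝ) < k - 1 := by linarith
  rcases le_total ((k - 2 - t) / (k - 1) : ℝ) 0 with h | h
  · simp [branchWeight, max_eq_left h]
  · congr 1
    rw [leafWeight_eq hk]
    have : (0 : ℝ) ≤ k - 2 - t := by
      rw [← div_mul_cancel₀ ((k : ℝ) - 2 - t) h1.ne']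
      exact mul_nonneg h h1.le
    exact max_eq_right (by linarith)

theorem branchWeight_pos (hk : 3 ≤ k) (ht : t = 0) : 0 < branchWeight k t := by
  have hk' : (3 : ℝ) ≤ k := by exact_mod_cast hk
  subst ht
  exact lt_max_of_lt_right (div_pos (by linarith) (by linarith))

theorem add_mul_branchWeight_pos (hk : 3 ≤ k) (ht : 0 ≤ t) {c : ℝ} (hc : 0 < c) :
    0 < t + c * branchWeight k t := by
  rcases ht.eq_or_lt with h | h
  · have := branchWeight_pos hk h.symm
    positivity
  · have := branchWeight_nonneg (k := k) (t := t)
    positivity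

end Parameters

section Limit

variable {V : Type*} [DecidableEq V] {T : SimpleGraph V} [T.LocallyFinite] {t t' : ℝ} {k : ℕ}
  {A : Finset V} {u v w o : V}

/-- The number of neighbours of `v` outside `A`. -/
def outDeg (T : SimpleGraph V) [T.LocallyFinite] (A : Finset V) (v : V) : ℕ :=
  (T.neighborFinset v \ A).card

theorem IsLeaf.outDeg_parent (h : IsLeaf T A u v) : outDeg T A u = outDeg T (insert v A) u + 1 := by
  unfold outDeg
  have hv : v ∈ T.neighborFinset u \ A := by simp [h.adj, h.notMem]
  rw [Finset.sdiff_insert, Finset.card_erase_add_one hv]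

theorem IsLeaf.outDeg_leaf (h : IsLeaf T A u v) (hreg : T.IsRegularOfDegree k) :
    outDeg T (insert v A) v + 1 = k := by
  unfold outDeg
  have : T.neighborFinset v \ insert v A = (T.neighborFinset v).erase u := by
    ext w
    simp only [Finset.mem_sdiff, SimpleGraph.mem_neighborFinset, Finset.mem_insert,
      Finset.mem_erase]
    constructor
    · rintro ⟨h1, h2⟩
      exact ⟨fun hw ↦ h2 (Or.inr (hw ▸ h.mem)), h1⟩
    · rintro ⟨h1, h2⟩
      refine ⟨h2, ?_⟩
      rintro (rfl | hw)
      · exact h2.ne rfl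
      · exact h1 (h.unique w hw h2.symm)
  have hu : u ∈ T.neighborFinset v := by simpa using h.adj.symm
  rw [this, Finset.card_erase_add_one hu, SimpleGraph.card_neighborFinset_eq_degree, hreg.degree_eq]

theorem IsLeaf.outDeg_other (h : IsLeaf T A u v) (hw : w ∈ A) (hwu : w ≠ u) :
    outDeg T (insert v A) w = outDeg T A w := by
  unfold outDeg
  rw [Finset.sdiff_insert, Finset.erase_eq_of_notMem]
  simp only [Finset.mem_sdiff, SimpleGraph.mem_neighborFinset, not_and]
  exact fun h' ↦ (hwu (h.unique w hw h')).elim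

/-- Sums in the model with the limiting boundary weights: a vertex with `d` neighbours outside `A`
is joined to infinity outside `A` with weight `d * branchWeight k t`. -/
noncomputable def limitGibbs (T : SimpleGraph V) [T.LocallyFinite] (k : ℕ) (t : ℝ) (A : Finset V)
    (f : Finset (Sym2 V) → Finset V → ℝ) : ℝ :=
  gibbs T t (fun _ ↦ 1) (fun v ↦ outDeg T A v * branchWeight k t) A f

/-- The mean of `f` over the states of a new leaf `v` and of its edge `e`, when the cluster of the
other end of `e` does not reach infinity through `v`: with probability `p` the edge `e` is open, with
probability `q` it is closed and `v` is joined to infinity, and otherwise neither holds. -/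
noncomputable def leafMean (p q : ℝ) (e : Sym2 V) (v : V) (f : Finset (Sym2 V) → Finset V → ℝ)
    (F : Finset (Sym2 V)) (P : Finset V) : ℝ :=
  p * f (insert e F) P + q * f F (insert v P) + (1 - p - q) * f F P

/-- The mean of `f` over the states of a new leaf `v`, attached at `u` by the edge `e`, given the
configuration on the set to which it is attached. If `u` is joined to infinity outside this set, then
each of the `d` neighbours of `u` outside it, `v` among them, is equally likely to be the exit. -/
noncomputable def revealLeaf (p q : ℝ) (d : ℕ) (e : Sym2 V) (u v : V)
    (f : Finset (Sym2 V) → Finset V → ℝ) (F : Finset (Sym2 V)) (P : Finset V) : ℝ :=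
  if u ∈ P then
    (1 / d : ℝ) * f (insert e F) (insert v (P.erase u)) + (1 - 1 / d) * leafMean p q e v f F P
  else leafMean p q e v f F P

omit [T.LocallyFinite] in
theorem gibbs_congr_weights {a b a' b' : V → ℝ} (ha : ∀ v ∈ A, a v = a' v)
    (hb : ∀ v ∈ A, b v = b' v) (f : Finset (Sym2 V) → Finset V → ℝ) :
    gibbs T t a b A f = gibbs T t a' b' A f := by
  refine Finset.sum_congr rfl fun F _ ↦ Finset.sum_congr rfl fun P _ ↦ ?_
  have : ∏ v ∈ A, (if v ∈ P then b v else a v) = ∏ v ∈ A, (if v ∈ P then b' v else a' v) :=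
    Finset.prod_congr rfl fun v hv ↦ by rw [ha v hv, hb v hv]
  unfold gibbsWeight
  rw [this]

/-- The Markov property of the limiting model. -/
theorem limitGibbs_insert (hk : 3 ≤ k) (hreg : T.IsRegularOfDegree k) (hA : Grow T {o} A)
    (hl : IsLeaf T A u v) (f : Finset (Sym2 V) → Finset V → ℝ) :
    limitGibbs T k t (insert v A) f = leafWeight k t * limitGibbs T k t A
      (revealLeaf (leafWeight k t)⁻¹ (branchWeight k t) (outDeg T A u) s(u, v) u v f) := by
  set D := leafWeight k t with hD
  set x := branchWeight k t with hx
  have hD0 : D ≠ 0 := (zero_lt_one.trans_le (one_le_leafWeight hk)).ne'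
  have hDx : D * x = (k - 1) * x := leafWeight_mul_branchWeight hk
  have hDt : D = 1 + t + (k - 1) * x := rfl
  have hd1 := hl.outDeg_parent
  have hd2 := hl.outDeg_leaf hreg
  have hd : (outDeg T A u : ℝ) = outDeg T (insert v A) u + 1 := by rw [hd1]; push_cast; ring
  have hd0 : (outDeg T A u : ℝ) ≠ 0 := by rw [hd]; positivity
  have hkv : (outDeg T (insert v A) v : ℝ) = k - 1 := by rw [← hd2]; push_cast; ring
  have hRHS : limitGibbs T k t A (revealLeaf D⁻¹ x (outDeg T A u) s(u, v) u v f) =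
      gibbs T t (Function.update (fun _ ↦ 1) u 1)
        (Function.update (fun v' ↦ outDeg T (insert v A) v' * x) u (outDeg T A u * x)) A
        (revealLeaf D⁻¹ x (outDeg T A u) s(u, v) u v f) := by
    refine gibbs_congr_weights (fun w _ ↦ ?_) (fun w hw ↦ ?_) _
    · rw [Function.update_eq_self_iff.2 rfl]
    · rcases eq_or_ne w u with rfl | hwu
      · simp [← hx]
      · simp [hwu, hl.outDeg_other hw hwu, hx]
  rw [hRHS, limitGibbs, gibbs_insert hA hl,
    gibbs_update hl.mem 1 (outDeg T A u * x), ← gibbs_const_mul]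
  refine gibbs_congr fun F _ P _ ↦ ?_
  have key : D * leafMean D⁻¹ x s(u, v) v f F P =
      t * f F P + (k - 1) * x * f F (insert v P) + f (insert s(u, v) F) P := by
    unfold leafMean
    have h1 : D * (1 - D⁻¹ - x) = t := by
      rw [mul_sub, mul_sub, mul_inv_cancel₀ hD0, hDx, hDt]; ring
    have h2 : D * D⁻¹ = 1 := mul_inv_cancel₀ hD0
    linear_combination (f F P) * h1 + f (insert s(u, v) F) P * h2 + f F (insert v P) * hDx
  by_cases hu : u ∈ P
  · simp only [peel, revealLeaf, hu, if_true]
    have h3 : (outDeg T A u : ℝ) * (1 / outDeg T A u) = 1 := mul_one_div_cancel hd0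
    rw [hkv]
    linear_combination (-(outDeg T (insert v A) u * x)) * key -
      f (insert s(u, v) F) (insert v (P.erase u)) * hDx - D * x *
      (f (insert s(u, v) F) (insert v (P.erase u)) - leafMean D⁻¹ x s(u, v) v f F P) * h3
      - D * x * leafMean D⁻¹ x s(u, v) v f F P * hd
  · simp only [peel, revealLeaf, hu, if_false]
    rw [hkv]
    linear_combination -key

theorem limitGibbs_singleton (hreg : T.IsRegularOfDegree k)
    (f : Finset (Sym2 V) → Finset V → ℝ) :
    limitGibbs T k t {o} f = t * f ∅ ∅ + k * branchWeight k t * f ∅ {o} := by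
  have : outDeg T {o} o = k := by
    unfold outDeg
    rw [Finset.sdiff_singleton_eq_erase, Finset.erase_eq_of_notMem (by simp),
      SimpleGraph.card_neighborFinset_eq_degree, hreg.degree_eq]
  rw [limitGibbs, gibbs_singleton, this, mul_one]

omit [T.LocallyFinite] in
theorem revealLeaf_one (p q : ℝ) (d : ℕ) (e : Sym2 V) :
    revealLeaf p q d e u v (fun _ _ ↦ (1 : ℝ)) = fun _ _ ↦ (1 : ℝ) := by
  funext F P
  unfold revealLeaf leafMean
  split_ifs <;> ring

theorem limitGibbs_one_pos (hk : 3 ≤ k) (ht : 0 ≤ t) (hreg : T.IsRegularOfDegree k)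
    (hA : Grow T {o} A) : 0 < limitGibbs T k t A fun _ _ ↦ 1 := by
  induction hA with
  | refl =>
    rw [limitGibbs_singleton hreg]
    simpa using add_mul_branchWeight_pos hk ht (c := k) (by positivity)
  | @step B u v hB hl ih =>
    rw [limitGibbs_insert hk hreg hB hl]
    refine mul_pos (zero_lt_one.trans_le (one_le_leafWeight hk)) ?_
    rw [revealLeaf_one]
    exact ih

end Limit

/-! ### Stochastic monotonicity of the limiting model -/

section Monotone

variable {V : Type*} [DecidableEq V] {T : SimpleGraph V} {t t' : ℝ} {k : ℕ}
  {A : Finset V} {u v w o : V} {p q p' q' : ℝ} {d : ℕ} {e : Sym2 V}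
  {f : Finset (Sym2 V) → Finset V → ℝ}

/-- `f` is increasing in the open edges and in the set of exits. -/
def Increasing (f : Finset (Sym2 V) → Finset V → ℝ) : Prop :=
  ∀ ⦃F F' : Finset (Sym2 V)⦄ ⦃P P' : Finset V⦄, F ⊆ F' → P ⊆ P' → f F P ≤ f F' P'

theorem leafMean_le (hp : 0 ≤ p) (hq : 0 ≤ q) (hpq : p + q ≤ 1) {F : Finset (Sym2 V)}
    {P : Finset V} {M : ℝ} (h1 : f (insert e F) P ≤ M) (h2 : f F (insert v P) ≤ M)
    (h3 : f F P ≤ M) : leafMean p q e v f F P ≤ M := by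
  have e1 := mul_le_mul_of_nonneg_left h1 hp
  have e2 := mul_le_mul_of_nonneg_left h2 hq
  have e3 := mul_le_mul_of_nonneg_left h3 (by linarith : 0 ≤ 1 - p - q)
  unfold leafMean
  linarith

theorem Increasing.leafMean (hf : Increasing f) (hp : 0 ≤ p) (hq : 0 ≤ q) (hpq : p + q ≤ 1) :
    Increasing (leafMean p q e v f) := by
  intro F F' P P' hF hP
  have e1 := mul_le_mul_of_nonneg_left (hf (Finset.insert_subset_insert e hF) hP) hp
  have e2 := mul_le_mul_of_nonneg_left (hf hF (Finset.insert_subset_insert v hP)) hq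
  have e3 := mul_le_mul_of_nonneg_left (hf hF hP) (by linarith : 0 ≤ 1 - p - q)
  unfold WiredGas.leafMean
  linarith

theorem one_div_natCast_le_one (d : ℕ) : (1 / d : ℝ) ≤ 1 := by
  rcases Nat.eq_zero_or_pos d with rfl | h
  · simp
  · rw [div_le_one (by positivity)]
    exact_mod_cast h

theorem Increasing.revealLeaf (hf : Increasing f) (hp : 0 ≤ p) (hq : 0 ≤ q) (hpq : p + q ≤ 1) :
    Increasing (revealLeaf p q d e u v f) := by
  intro F F' P P' hF hP
  have hm := hf.leafMean (e := e) (v := v) hp hq hpq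
  have hd : (0 : ℝ) ≤ 1 / d := by positivity
  have hd' : (0 : ℝ) ≤ 1 - 1 / d := sub_nonneg.2 (one_div_natCast_le_one d)
  unfold WiredGas.revealLeaf
  by_cases hu : u ∈ P
  · rw [if_pos hu, if_pos (hP hu)]
    exact add_le_add (mul_le_mul_of_nonneg_left (hf (Finset.insert_subset_insert _ hF)
      (Finset.insert_subset_insert _ (Finset.erase_subset_erase _ hP))) hd)
      (mul_le_mul_of_nonneg_left (hm hF hP) hd')
  · rw [if_neg hu]
    split_ifs with hu'
    · have hP' : P ⊆ P'.erase u := fun w hw ↦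
        Finset.mem_erase.2 ⟨fun h ↦ hu (h ▸ hw), hP hw⟩
      have h1 : WiredGas.leafMean p q e v f F P ≤
          f (insert e F') (insert v (P'.erase u)) := by
        refine leafMean_le hp hq hpq (hf ?_ ?_) (hf ?_ ?_) (hf ?_ ?_)
        · exact Finset.insert_subset_insert _ hF
        · exact hP'.trans (Finset.subset_insert _ _)
        · exact hF.trans (Finset.subset_insert _ _)
        · exact Finset.insert_subset_insert _ hP'
        · exact hF.trans (Finset.subset_insert _ _)
        · exact hP'.trans (Finset.subset_insert _ _)
      have h2 := hm hF hP
      have e1 := mul_le_mul_of_nonneg_left h1 hd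
      have e2 := mul_le_mul_of_nonneg_left h2 hd'
      linarith
    · exact hm hF hP

theorem revealLeaf_le_revealLeaf (hf : Increasing f) (hp : p ≤ p') (hq : q ≤ q')
    (F : Finset (Sym2 V)) (P : Finset V) :
    revealLeaf p q d e u v f F P ≤ revealLeaf p' q' d e u v f F P := by
  have hd' : (0 : ℝ) ≤ 1 - 1 / d := sub_nonneg.2 (one_div_natCast_le_one d)
  have hm : leafMean p q e v f F P ≤ leafMean p' q' e v f F P := by
    have e1 := mul_le_mul_of_nonneg_left
      (hf (Finset.subset_insert e F) (subset_refl P)) (sub_nonneg.2 hp)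
    have e2 := mul_le_mul_of_nonneg_left
      (hf (subset_refl F) (Finset.subset_insert v P)) (sub_nonneg.2 hq)
    unfold leafMean
    linarith
  unfold revealLeaf
  split_ifs
  · linarith [mul_le_mul_of_nonneg_left hm hd']
  · exact hm

theorem inv_leafWeight_add_branchWeight_le (hk : 3 ≤ k) (ht : 0 ≤ t) :
    (leafWeight k t)⁻¹ + branchWeight k t ≤ 1 := by
  have hD : 0 < leafWeight k t := zero_lt_one.trans_le (one_le_leafWeight hk)
  have h1 := leafWeight_mul_branchWeight (t := t) hk
  have h2 : leafWeight k t = 1 + t + (k - 1) * branchWeight k t := rfl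
  refine le_of_mul_le_mul_left ?_ hD
  rw [mul_add, mul_inv_cancel₀ hD.ne']
  linarith

variable [T.LocallyFinite]

/-- The limiting model is stochastically decreasing in `t = 1 / β`: this holds at a single vertex,
and the conditional law of a new leaf is monotone both in `t` and in the configuration. -/
theorem limitGibbs_mono (hk : 3 ≤ k) (hreg : T.IsRegularOfDegree k) (ht : 0 ≤ t) (htt : t ≤ t')
    (hA : Grow T {o} A) (hf : Increasing f) :
    limitGibbs T k t' A f / limitGibbs T k t' A (fun _ _ ↦ 1) ≤
      limitGibbs T k t A f / limitGibbs T k t A (fun _ _ ↦ 1) := by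
  have ht' := ht.trans htt
  induction hA generalizing f with
  | refl =>
    have hpos := limitGibbs_one_pos hk ht hreg (Grow.refl (A := {o}))
    have hpos' := limitGibbs_one_pos hk ht' hreg (Grow.refl (A := {o}))
    rw [div_le_div_iff₀ hpos' hpos]
    simp only [limitGibbs_singleton hreg, mul_one]
    have h1 := hf (subset_refl ∅) (Finset.empty_subset {o})
    have h2 : t * (k * branchWeight k t') ≤ t' * (k * branchWeight k t) :=
      mul_le_mul htt (mul_le_mul_of_nonneg_left (branchWeight_anti hk htt) (by positivity))
        (mul_nonneg (by positivity) branchWeight_nonneg) ht'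
    have h3 := mul_nonneg (sub_nonneg.2 h1) (sub_nonneg.2 h2)
    linarith
  | @step B u v hB hl ih =>
    have hstep : ∀ s : ℝ, limitGibbs T k s (insert v B) f /
        limitGibbs T k s (insert v B) (fun _ _ ↦ 1) =
        limitGibbs T k s B (revealLeaf (leafWeight k s)⁻¹ (branchWeight k s) (outDeg T B u)
          s(u, v) u v f) / limitGibbs T k s B (fun _ _ ↦ 1) := by
      intro s
      have hD : 0 < leafWeight k s := zero_lt_one.trans_le (one_le_leafWeight hk)
      rw [limitGibbs_insert hk hreg hB hl, limitGibbs_insert hk hreg hB hl,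
        mul_div_mul_left _ _ hD.ne', revealLeaf_one]
    rw [hstep, hstep]
    have hD : 0 < leafWeight k t := zero_lt_one.trans_le (one_le_leafWeight hk)
    have hD' : 0 < leafWeight k t' := zero_lt_one.trans_le (one_le_leafWeight hk)
    refine (ih (hf.revealLeaf (inv_nonneg.2 hD'.le) branchWeight_nonneg
      (inv_leafWeight_add_branchWeight_le hk ht'))).trans ?_
    refine div_le_div_of_nonneg_right ?_ (limitGibbs_one_pos hk ht hreg hB).le
    refine gibbs_le_gibbs ht (fun _ _ ↦ zero_le_one)
      (fun _ _ ↦ mul_nonneg (by positivity) branchWeight_nonneg) fun F P ↦ ?_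
    exact revealLeaf_le_revealLeaf hf (inv_anti₀ hD (leafWeight_mono hk htt))
      (branchWeight_anti hk htt) F P

/-- The model on a single edge: the two ends are not both joined to infinity if it is open. -/
theorem limitGibbs_pair (hk : 3 ≤ k) (hreg : T.IsRegularOfDegree k) {x y : V} (hxy : T.Adj x y)
    (f : Finset (Sym2 V) → Finset V → ℝ) :
    limitGibbs T k t {x, y} f =
      t * f {s(x, y)} ∅ + (k - 1) * branchWeight k t * (f {s(x, y)} {x} + f {s(x, y)} {y}) +
      t * t * f ∅ ∅ + t * ((k - 1) * branchWeight k t) * (f ∅ {x} + f ∅ {y}) +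
      ((k - 1) * branchWeight k t) ^ 2 * f ∅ {x, y} := by
  have hne := hxy.ne
  have hl : IsLeaf T {x} x y :=
    ⟨by simp, by simpa using hne.symm, hxy, fun w hw _ ↦ by simpa using hw⟩
  have h1 := hl.outDeg_parent
  have hx : outDeg T {x} x = k := by
    unfold outDeg
    rw [Finset.sdiff_singleton_eq_erase, Finset.erase_eq_of_notMem (by simp),
      SimpleGraph.card_neighborFinset_eq_degree, hreg.degree_eq]
  have hk0 : (k : ℝ) ≠ 0 := by
    have : k ≠ 0 := by omega
    exact_mod_cast this
  have hD0 : leafWeight k t ≠ 0 := (zero_lt_one.trans_le (one_le_leafWeight hk)).ne'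
  have hDx : leafWeight k t * branchWeight k t = (k - 1) * branchWeight k t :=
    leafWeight_mul_branchWeight hk
  have hD : leafWeight k t = 1 + t + (k - 1) * branchWeight k t := rfl
  have h2 : leafWeight k t * (leafWeight k t)⁻¹ = 1 := mul_inv_cancel₀ hD0
  have h3 : (k : ℝ) * (1 / k) = 1 := mul_one_div_cancel hk0
  rw [Finset.pair_comm, limitGibbs_insert hk hreg Grow.refl hl, limitGibbs_singleton hreg, hx]
  have e1 : ({x} : Finset V).erase x = ∅ := by simp
  simp only [revealLeaf, leafMean, Finset.notMem_empty, if_false, Finset.mem_singleton, if_true,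
    insert_empty_eq, e1, Finset.pair_comm y x]
  set D := leafWeight k t
  set z := branchWeight k t
  have h4 : D * (1 - D⁻¹ - z) = t := by rw [mul_sub, mul_sub, h2, hDx, hD]; ring
  have h5 : (k : ℝ) * (1 - 1 / k) = k - 1 := by rw [mul_sub, h3, mul_one]
  linear_combination (t * f {s(x, y)} ∅) * h2 + t * f ∅ {y} * hDx + t * f ∅ ∅ * h4 +
    f {s(x, y)} {y} * (z * D * h3 + hDx) +
    f {s(x, y)} {x} * (z * D * D⁻¹ * h5 + (k - 1) * z * h2) +
    f ∅ {x, y} * (z * D * z * h5 + (k - 1) * z * hDx) +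
    f ∅ {x} * (z * D * (1 - D⁻¹ - z) * h5 + (k - 1) * z * h4)

omit [T.LocallyFinite] in
/-- Revealing a leaf commutes with conditioning on the state of another edge. -/
theorem revealLeaf_mul_edge {e' : Sym2 V} (he : e' ≠ e) (φ : Prop → ℝ) :
    revealLeaf p q d e u v (fun F P ↦ f F P * φ (e' ∈ F)) =
      fun F P ↦ revealLeaf p q d e u v f F P * φ (e' ∈ F) := by
  funext F P
  have : (e' ∈ insert e F) = (e' ∈ F) := by simp [he]
  unfold revealLeaf leafMean
  simp only [this]
  split_ifs <;> ring

omit [T.LocallyFinite] in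
theorem revealLeaf_insert_edge {e' : Sym2 V} (hfe : ∀ F P, f (insert e' F) P = f F P)
    (F : Finset (Sym2 V)) (P : Finset V) :
    revealLeaf p q d e u v f (insert e' F) P = revealLeaf p q d e u v f F P := by
  unfold revealLeaf leafMean
  simp only [Finset.insert_comm e e', hfe]

/-- The Markov property, given the state of an edge `e'` of `A`. -/
theorem limitGibbs_insert_mul_edge (hk : 3 ≤ k) (hreg : T.IsRegularOfDegree k)
    (hA : Grow T {o} A) (hl : IsLeaf T A u v) {e' : Sym2 V} (he : e' ≠ s(u, v)) (φ : Prop → ℝ) :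
    limitGibbs T k t (insert v A) (fun F P ↦ f F P * φ (e' ∈ F)) =
      leafWeight k t * limitGibbs T k t A (fun F P ↦ revealLeaf (leafWeight k t)⁻¹
        (branchWeight k t) (outDeg T A u) s(u, v) u v f F P * φ (e' ∈ F)) := by
  rw [limitGibbs_insert hk hreg hA hl, revealLeaf_mul_edge he]

omit [T.LocallyFinite] in
theorem grow_pair {x y : V} (hxy : T.Adj x y) : Grow T {x} {x, y} := by
  rw [Finset.pair_comm]
  exact Grow.refl.step
    ⟨by simp, by simpa using hxy.ne', hxy, fun w hw _ ↦ by simpa using hw⟩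

/-- Both states of an edge have positive probability in the limiting model; the weight `φ` of the
state of the edge covers both cases. -/
theorem limitGibbs_edge_pos (hk : 3 ≤ k) (hreg : T.IsRegularOfDegree k) (ht : 0 ≤ t) {x y : V}
    (hxy : T.Adj x y) (hA : Grow T {x, y} A) (φ : Prop → ℝ) (hφ : 0 ≤ φ True) (hφ' : 0 ≤ φ False)
    (h : 0 < φ True + φ False) :
    0 < limitGibbs T k t A (fun F _ ↦ 1 * φ (s(x, y) ∈ F)) := by
  induction hA with
  | refl =>
    rw [limitGibbs_pair hk hreg hxy]
    have h1 : s(x, y) ∈ ({s(x, y)} : Finset (Sym2 V)) := by simp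
    have h2 : s(x, y) ∉ (∅ : Finset (Sym2 V)) := by simp
    simp only [h1, h2, one_mul]
    have hk1 : (0 : ℝ) < k - 1 := by
      have : (3 : ℝ) ≤ k := by exact_mod_cast hk
      linarith
    have hr : 0 ≤ (k - 1) * branchWeight k t := mul_nonneg hk1.le branchWeight_nonneg
    have htr := add_mul_branchWeight_pos hk ht hk1
    set r := (k - 1) * branchWeight k t
    have hform : t * φ True + r * (φ True + φ True) + t * t * φ False +
        t * r * (φ False + φ False) + r ^ 2 * φ False =
        (t + r) * φ True + r * φ True + (t + r) ^ 2 * φ False := by ring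
    rw [hform]
    rcases hφ.eq_or_lt with h0 | h0
    · have : 0 < φ False := by linarith
      have e1 : 0 < (t + r) ^ 2 * φ False := by positivity
      rw [← h0]
      linarith
    · have e1 : 0 < (t + r) * φ True := by positivity
      have e2 : 0 ≤ r * φ True := by positivity
      have e3 : 0 ≤ (t + r) ^ 2 * φ False := by positivity
      linarith
  | @step B u v hB hl ih =>
    have hne : s(x, y) ≠ s(u, v) := fun h' ↦ hl.edge_notMem <| by
      rw [← h', mem_edgesIn]
      exact ⟨hB.subset (by simp), hB.subset (by simp), hxy⟩
    rw [limitGibbs_insert_mul_edge (f := fun _ _ ↦ 1) hk hreg ((grow_pair hxy).trans hB) hl hne,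
      revealLeaf_one]
    exact mul_pos (zero_lt_one.trans_le (one_le_leafWeight hk)) ih

/-- Negative dependence in the limiting model. For the single edge `s(x, y)`, closing the edge
removes the constraint that `x` and `y` are not both joined to infinity on their own sides; the
leaves that are added afterwards depend monotonically on these states. -/
theorem limitGibbs_negative_dependence (hk : 3 ≤ k) (hreg : T.IsRegularOfDegree k) (ht : 0 ≤ t)
    {x y : V} (hxy : T.Adj x y) (hA : Grow T {x, y} A) (hf : Increasing f)
    (hfe : ∀ F P, f (insert s(x, y) F) P = f F P) {φ ψ : Prop → ℝ} (hφ : φ True = 1)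
    (hφ' : φ False = 0) (hψ : ψ True = 0) (hψ' : ψ False = 1) :
    limitGibbs T k t A (fun F P ↦ f F P * φ (s(x, y) ∈ F)) *
        limitGibbs T k t A (fun F _ ↦ 1 * ψ (s(x, y) ∈ F)) ≤
      limitGibbs T k t A (fun F P ↦ f F P * ψ (s(x, y) ∈ F)) *
        limitGibbs T k t A (fun F _ ↦ 1 * φ (s(x, y) ∈ F)) := by
  induction hA generalizing f with
  | refl =>
    have h1 : s(x, y) ∈ ({s(x, y)} : Finset (Sym2 V)) := by simp
    have h2 : s(x, y) ∉ (∅ : Finset (Sym2 V)) := by simp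
    have h3 : ∀ P, f {s(x, y)} P = f ∅ P := fun P ↦ by simpa using hfe ∅ P
    simp only [limitGibbs_pair hk hreg hxy, h1, h2, hφ, hφ', hψ, hψ', h3]
    have hk1 : (0 : ℝ) < k - 1 := by
      have : (3 : ℝ) ≤ k := by exact_mod_cast hk
      linarith
    have hr : 0 ≤ (k - 1) * branchWeight k t := mul_nonneg hk1.le branchWeight_nonneg
    set r := (k - 1) * branchWeight k t
    have m1 := mul_nonneg (mul_nonneg (mul_nonneg hr hr) ht) (sub_nonneg.2
      (hf (subset_refl ∅) (Finset.empty_subset {x, y})))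
    have m2 := mul_nonneg (mul_nonneg (mul_nonneg hr hr) hr) (sub_nonneg.2
      (hf (subset_refl ∅) (show {x} ⊆ ({x, y} : Finset V) by simp)))
    have m3 := mul_nonneg (mul_nonneg (mul_nonneg hr hr) hr) (sub_nonneg.2
      (hf (subset_refl ∅) (show {y} ⊆ ({x, y} : Finset V) by simp)))
    linear_combination m1 + m2 + m3
  | @step B u v hB hl ih =>
    have hne : s(x, y) ≠ s(u, v) := fun h' ↦ hl.edge_notMem <| by
      rw [← h', mem_edgesIn]
      exact ⟨hB.subset (by simp), hB.subset (by simp), hxy⟩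
    have hg := (grow_pair hxy).trans hB
    have hD : 0 < leafWeight k t := zero_lt_one.trans_le (one_le_leafWeight hk)
    rw [limitGibbs_insert_mul_edge (f := fun _ _ ↦ 1) hk hreg hg hl hne,
      limitGibbs_insert_mul_edge (f := fun _ _ ↦ 1) hk hreg hg hl hne,
      limitGibbs_insert_mul_edge hk hreg hg hl hne,
      limitGibbs_insert_mul_edge hk hreg hg hl hne, revealLeaf_one]
    have := ih (hf.revealLeaf (d := outDeg T B u) (e := s(u, v)) (u := u) (v := v)
      (inv_nonneg.2 hD.le) branchWeight_nonneg
      (inv_leafWeight_add_branchWeight_le hk ht)) fun F P ↦ revealLeaf_insert_edge hfe F P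
    have h2 := mul_le_mul_of_nonneg_left this (mul_nonneg hD.le hD.le)
    linear_combination h2

end Monotone

/-! ### Cycles of multigraphs -/

section Bridges

variable {α E : Type*} {G : Graph α E}

/-- In an acyclic multigraph every edge is a bridge: the ends of an edge `e` are not joined by a
path of other edges. -/
theorem IsAcyclic.not_reflTransGen (hG : IsAcyclic G) {e : E} {x y : α} (he : G.IsLink e x y) :
    ¬ Relation.ReflTransGen (fun a b ↦ ∃ e' ≠ e, G.IsLink e' a b) x y := by
  classical
  intro h
  -- a simple path from `x` to `y` without `e`
  let H : SimpleGraph α := SimpleGraph.fromRel fun a b ↦ ∃ e' ≠ e, G.IsLink e' a b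
  have hHadj : ∀ a b, H.Adj a b → ∃ e' ≠ e, G.IsLink e' a b := by
    intro a b hab
    rcases ((SimpleGraph.fromRel_adj _ _ _).1 hab).2 with ⟨e', h1, h2⟩ | ⟨e', h1, h2⟩
    exacts [⟨e', h1, h2⟩, ⟨e', h1, h2.symm⟩]
  have hreach : ∀ z, Relation.ReflTransGen (fun a b ↦ ∃ e' ≠ e, G.IsLink e' a b) x z →
      H.Reachable x z := by
    intro z hz
    induction hz with
    | refl => exact .refl _
    | @tail b c _ hbc ih =>
      rcases eq_or_ne b c with rfl | hne
      · exact ih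
      · exact ih.trans
          (SimpleGraph.Adj.reachable ((SimpleGraph.fromRel_adj _ _ _).2 ⟨hne, Or.inl hbc⟩))
  obtain ⟨p, hp⟩ := (hreach y h).exists_isPath
  have hinj := hp.getVert_injOn
  have hstep : ∀ i : Fin p.length, ∃ e' ≠ e, G.IsLink e' (p.getVert i) (p.getVert (i + 1)) :=
    fun i ↦ hHadj _ _ (p.adj_getVert_succ i.2)
  choose f hfe hf using hstep
  refine hG p.length (fun i ↦ p.getVert i) (Fin.snoc f e) ?_ ?_ ?_
  · intro i j hij
    exact Fin.ext (hinj (by simpa using Nat.lt_succ_iff.1 i.2) (by simpa using Nat.lt_succ_iff.1 j.2) hij)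
  · intro i j
    refine Fin.lastCases ?_ (fun i ↦ ?_) i <;> refine Fin.lastCases ?_ (fun j ↦ ?_) j
    · simp
    · simpa using fun h' ↦ (hfe j h'.symm).elim
    · simpa using fun h' ↦ (hfe i h').elim
    · simp only [Fin.snoc_castSucc]
      intro hij
      have h1 := hf i
      have h2 := hf j
      rw [hij] at h1
      have hv : ∀ a b : ℕ, a ≤ p.length → b ≤ p.length → p.getVert a = p.getVert b → a = b :=
        fun a b ha hb hab ↦ hinj ha hb hab
      have hi := i.2
      have hj := j.2
      rcases h1.eq_and_eq_or_eq_and_eq h2 with ⟨h3, -⟩ | ⟨h3, h4⟩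
      · have := hv _ _ hi.le hj.le h3
        ext
        simpa using this
      · have e1 := hv _ _ hi.le (by omega) h3
        have e2 := hv _ _ (by omega) hj.le h4
        omega
  · intro i
    refine Fin.lastCases ?_ (fun i ↦ ?_) i
    · simpa using he.symm
    · simpa [Fin.val_add_one_of_lt (Fin.castSucc_lt_last i)] using hf i

/-- The converse of `IsAcyclic.not_reflTransGen`: a cycle without one of its edges is a path. -/
theorem isAcyclic_of_bridges
    (h : ∀ e x y, G.IsLink e x y →
      ¬ Relation.ReflTransGen (fun a b ↦ ∃ e' ≠ e, G.IsLink e' a b) x y) : IsAcyclic G := by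
  intro n v e _ he hlink
  have hlast : G.IsLink (e (Fin.last n)) (v 0) (v (Fin.last n)) := by
    have := hlink (Fin.last n)
    rw [Fin.last_add_one] at this
    exact this.symm
  refine h _ _ _ hlast ?_
  have key : ∀ i : ℕ, ∀ hi : i < n + 1,
      Relation.ReflTransGen (fun a b ↦ ∃ e' ≠ e (Fin.last n), G.IsLink e' a b) (v 0) (v ⟨i, hi⟩) := by
    intro i
    induction i with
    | zero => exact fun _ ↦ .refl
    | succ i ih =>
      intro hi
      refine (ih (by omega)).tail ⟨e ⟨i, by omega⟩, fun h' ↦ ?_, ?_⟩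
      · have := congrArg Fin.val (he h')
        simp at this
        omega
      · have := hlink ⟨i, by omega⟩
        convert this using 2
        rw [Fin.ext_iff, Fin.val_add_one_of_lt]
        rw [Fin.lt_def]
        simp
        omega
  exact key n (by omega)

end Bridges

/-! ### Forests and spanning trees of the wired graph -/

section Wired

variable {V : Type*} [DecidableEq V] {T : SimpleGraph V} [T.LocallyFinite] {S : Finset V}
  {F : Finset (Sym2 V)}

/-- The vertices of `S` and their neighbours, as a finite set. -/
def nbhd (T : SimpleGraph V) [T.LocallyFinite] (S : Finset V) : Finset V :=
  S ∪ S.biUnion fun v ↦ T.neighborFinset v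

theorem mem_nbhd {v : V} : v ∈ nbhd T S ↔ v ∈ S ∨ ∃ u ∈ S, T.Adj u v := by
  simp [nbhd]

theorem subset_nbhd : S ⊆ nbhd T S := Finset.subset_union_left

/-- The boundary vertices of a connected set are leaves, in any order. -/
theorem grow_nbhd (hT : T.IsAcyclic) (hS : (T.induce (S : Set V)).Connected) :
    Grow T S (nbhd T S) := by
  have key : ∀ N : Finset V, N ⊆ nbhd T S → Grow T S (S ∪ N) := by
    intro N
    induction N using Finset.induction_on with
    | empty => exact fun _ ↦ by simpa using Grow.refl
    | @insert v N hv ih =>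
      intro hN
      have hg := ih ((Finset.subset_insert v N).trans hN)
      by_cases hvS : v ∈ S
      · rwa [Finset.union_insert, Finset.insert_eq_of_mem (Finset.mem_union_left _ hvS)]
      · obtain ⟨u, hu, huv⟩ := (mem_nbhd.1 (hN (Finset.mem_insert_self v N))).resolve_left hvS
        rw [Finset.union_insert]
        exact hg.step (isLeaf_of_connected hT (hg.connected hS) (Finset.mem_union_left _ hu)
          (by simp [hvS, hv]) huv)
  have := key _ subset_rfl
  rwa [Finset.union_eq_right.2 subset_nbhd] at this

/-- A vertex of the boundary of `S` has only one neighbour in `S` and its boundary. -/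
theorem eq_of_adj_boundary (hT : T.IsAcyclic) (hS : (T.induce (S : Set V)).Connected) {p u w : V}
    (hpS : p ∉ S) (hu : u ∈ nbhd T S) (hw : w ∈ nbhd T S) (hpu : T.Adj p u) (hpw : T.Adj p w)
    (hp : p ∈ nbhd T S) : u = w := by
  -- there are no edges inside the boundary
  have key : ∀ z ∈ nbhd T S, T.Adj p z → z ∈ S := by
    intro z hz hpz
    by_contra hzS
    obtain ⟨a, ha, hap⟩ := (mem_nbhd.1 hp).resolve_left hpS
    obtain ⟨b, hb, hbz⟩ := (mem_nbhd.1 hz).resolve_left hzS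
    have hl := isLeaf_of_connected hT hS hb hzS hbz
    have hl' := isLeaf_of_connected hT (hl.connected_insert hS) (u := z) (v := p)
      (Finset.mem_insert_self _ _) (by simp [hpz.ne, hpS]) hpz.symm
    exact hzS (hl'.unique a (Finset.mem_insert_of_mem ha) hap ▸ ha)
  have hl := isLeaf_of_connected hT hS (key u hu hpu) hpS hpu.symm
  exact (hl.unique w (key w hw hpw) hpw.symm).symm

/-- The subgraph of the wired graph with the edges in `F`. -/
noncomputable def wiredSubgraph (T : SimpleGraph V) (S : Finset V) (F : Finset (Sym2 V)) :
    Graph (Option V) (Sym2 V) :=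
  (wiredGraph T (S : Set V)).restrict (F : Set (Sym2 V))

theorem coe_nbhd : (nbhd T S : Set V) = withNeighbours T (S : Set V) := by
  ext v
  simp [mem_nbhd, withNeighbours]

theorem isLink_wiredSubgraph (hF : F ⊆ edgesIn T (nbhd T S)) {e : Sym2 V} {x y : Option V} :
    (wiredSubgraph T S F).IsLink e x y ↔
      ∃ a b, e = s(a, b) ∧ s(a, b) ∈ F ∧ merge (S : Set V) a = x ∧ merge (S : Set V) b = y := by
  change (e ∈ (F : Set (Sym2 V)) ∧ Relation.Map _ _ _ x y) ↔ _
  constructor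
  · rintro ⟨he, a, b, ⟨⟨rfl, h1⟩, ha, hb⟩, rfl, rfl⟩
    exact ⟨a, b, rfl, he, rfl, rfl⟩
  · rintro ⟨a, b, rfl, he, rfl, rfl⟩
    have := mem_edgesIn.1 (hF he)
    refine ⟨he, a, b, ⟨⟨rfl, this.2.2⟩, ?_, ?_⟩, rfl, rfl⟩
    · rw [← coe_nbhd]; exact this.1
    · rw [← coe_nbhd]; exact this.2.1

omit [DecidableEq V] in
theorem merge_of_mem {v : V} (h : v ∈ S) : merge (S : Set V) v = some v := if_pos h

omit [DecidableEq V] in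
theorem merge_of_notMem {v : V} (h : v ∉ S) : merge (S : Set V) v = none := if_neg h

theorem eq_or_notMem_of_merge_eq {a c : V} (h : merge (S : Set V) a = merge (S : Set V) c) :
    a = c ∨ (a ∉ S ∧ c ∉ S) := by
  by_cases ha : a ∈ S <;> by_cases hc : c ∈ S
  · left
    simpa [merge_of_mem ha, merge_of_mem hc] using h
  · simp [merge_of_mem ha, merge_of_notMem hc] at h
  · simp [merge_of_notMem ha, merge_of_mem hc] at h
  · exact Or.inr ⟨ha, hc⟩

/-- A path in the wired graph either is a path in the tree or meets the boundary. -/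
theorem reach_of_wired {R : Finset (Sym2 V)} {r : Option V → Option V → Prop}
    (hr : ∀ x y, r x y → ∃ a b, s(a, b) ∈ R ∧ merge (S : Set V) a = x ∧ merge (S : Set V) b = y)
    {a : V} {z : Option V} (h : Relation.ReflTransGen r (merge (S : Set V) a) z) :
    (∃ c, Reach R a c ∧ merge (S : Set V) c = z) ∨ ∃ p, p ∉ S ∧ Reach R a p := by
  induction h with
  | refl => exact Or.inl ⟨a, .refl, rfl⟩
  | tail _ hyz ih =>
    rcases ih with ⟨c, hac, hc⟩ | h
    · obtain ⟨c₁, c₂, hR, h1, h2⟩ := hr _ _ hyz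
      rcases eq_or_notMem_of_merge_eq (hc.trans h1.symm) with rfl | ⟨hcS, -⟩
      · exact Or.inl ⟨c₂, hac.trans (.single hR), h2⟩
      · exact Or.inr ⟨c, hcS, hac⟩
    · exact Or.inr h

/-- The open edges `F` of the wired graph form a forest if and only if they do not join distinct
vertices of the boundary within the tree. -/
theorem isAcyclic_wiredSubgraph_iff (hT : T.IsAcyclic) (hS : (T.induce (S : Set V)).Connected)
    (hF : F ⊆ edgesIn T (nbhd T S)) :
    IsAcyclic (wiredSubgraph T S F) ↔ Separated F (nbhd T S \ S) := by
  have hadj : ∀ a b, s(a, b) ∈ F → a ∈ nbhd T S ∧ b ∈ nbhd T S ∧ T.Adj a b :=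
    fun a b h ↦ mem_edgesIn.1 (hF h)
  constructor
  · intro hac p hp q hq hpq
    by_contra hne
    rw [Finset.mem_sdiff] at hp hq
    obtain ⟨u, hpu, -⟩ : ∃ u, s(p, u) ∈ F ∧ Reach F u q := by
      rcases Relation.ReflTransGen.cases_head hpq with h | ⟨u, h1, h2⟩
      · exact (hne h).elim
      · exact ⟨u, h1, h2⟩
    -- the only edge at `p` is used once, so `u` is joined to `q` by the other edges
    have hur : ∀ z, Reach F p z → z = p ∨ Reach (F.erase s(p, u)) u z := by
      intro z hz
      induction hz with
      | refl => exact Or.inl rfl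
      | @tail b c _ hbc ih =>
        by_cases he : s(b, c) = s(p, u)
        · rcases Sym2.eq_iff.1 he with ⟨-, rfl⟩ | ⟨-, rfl⟩
          · exact Or.inr .refl
          · exact Or.inl rfl
        · rcases ih with rfl | ih
          · have h1 := hadj _ _ hbc
            have h2 := hadj _ _ hpu
            rw [eq_of_adj_boundary hT hS hp.2 h1.2.1 h2.2.1 h1.2.2 h2.2.2 hp.1] at he
            exact (he rfl).elim
          · exact Or.inr (ih.trans (.single (Finset.mem_erase.2 ⟨he, hbc⟩)))
    have huq := (hur q hpq).resolve_left (Ne.symm hne)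
    refine hac.not_reflTransGen (e := s(p, u)) (x := merge (S : Set V) u)
      (y := merge (S : Set V) p) ?_ ?_
    · exact (isLink_wiredSubgraph hF).2 ⟨u, p, Sym2.eq_swap, by rwa [Sym2.eq_swap], rfl, rfl⟩
    · rw [merge_of_notMem hp.2, ← merge_of_notMem hq.2]
      refine Relation.ReflTransGen.lift (merge (S : Set V)) (fun b c hbc ↦ ?_) _ _ huq
      obtain ⟨h1, h2⟩ := Finset.mem_erase.1 hbc
      exact ⟨s(b, c), h1, (isLink_wiredSubgraph hF).2 ⟨b, c, rfl, h2, rfl, rfl⟩⟩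
  · intro hsep
    refine isAcyclic_of_bridges fun e x y hlink hpath ↦ ?_
    obtain ⟨a, b, rfl, hab, rfl, rfl⟩ := (isLink_wiredSubgraph hF).1 hlink
    have hr : ∀ x y, (∃ e' ≠ s(a, b), (wiredSubgraph T S F).IsLink e' x y) →
        ∃ c d, s(c, d) ∈ F.erase s(a, b) ∧ merge (S : Set V) c = x ∧ merge (S : Set V) d = y := by
      rintro x y ⟨e', hne, h⟩
      obtain ⟨c, d, rfl, h1, h2, h3⟩ := (isLink_wiredSubgraph hF).1 h
      exact ⟨c, d, Finset.mem_erase.2 ⟨hne, h1⟩, h2, h3⟩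
    have hnot : ¬ Reach (F.erase s(a, b)) a b := by
      intro h
      refine not_reflTransGen_of_isAcyclic hT (hadj a b hab).2.2
        (Relation.ReflTransGen.mono (fun c d hcd ↦ ?_) _ _ h)
      obtain ⟨h1, h2⟩ := Finset.mem_erase.1 hcd
      exact ⟨edgesIn_subset_edgeSet (hF h2), h1⟩
    have hpath' : Relation.ReflTransGen
        (fun x y ↦ ∃ e' ≠ s(a, b), (wiredSubgraph T S F).IsLink e' x y)
        (merge (S : Set V) b) (merge (S : Set V) a) := by
      have : Std.Symm (fun x y ↦ ∃ e' ≠ s(a, b), (wiredSubgraph T S F).IsLink e' x y) :=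
        ⟨fun x y ⟨e', h1, h2⟩ ↦ ⟨e', h1, h2.symm⟩⟩
      exact Relation.ReflTransGen.stdSymm.symm _ _ hpath
    -- both ends of the edge are joined to the boundary by other edges
    have hexit : ∀ c d, ¬ Reach (F.erase s(a, b)) c d → Relation.ReflTransGen
        (fun x y ↦ ∃ e' ≠ s(a, b), (wiredSubgraph T S F).IsLink e' x y)
        (merge (S : Set V) c) (merge (S : Set V) d) →
        ∃ p, p ∉ S ∧ Reach (F.erase s(a, b)) c p := by
      intro c d hcd h
      rcases reach_of_wired hr h with ⟨z, h1, h2⟩ | h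
      · rcases eq_or_notMem_of_merge_eq h2 with rfl | ⟨hz, -⟩
        · exact (hcd h1).elim
        · exact ⟨z, hz, h1⟩
      · exact h
    obtain ⟨p, hpS, hp⟩ := hexit a b hnot hpath
    obtain ⟨q, hqS, hq⟩ := hexit b a (fun h ↦ hnot h.symm) hpath'
    have hsub : F.erase s(a, b) ⊆ F := Finset.erase_subset _ _
    have hpN : p ∈ nbhd T S := (hp.mono hsub).mem hF (hadj a b hab).1
    have hqN : q ∈ nbhd T S := (hq.mono hsub).mem hF (hadj a b hab).2.1
    have hpq : p = q := hsep p (Finset.mem_sdiff.2 ⟨hpN, hpS⟩) q (Finset.mem_sdiff.2 ⟨hqN, hqS⟩)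
      (((hp.mono hsub).symm.trans (.single hab)).trans (hq.mono hsub))
    exact hnot (hp.trans (hpq ▸ hq.symm))

/-- Connected configurations on the wired graph are those that join all vertices to the boundary. -/
theorem isConnected_wiredSubgraph_iff (hF : F ⊆ edgesIn T (nbhd T S))
    (hne : (nbhd T S \ S).Nonempty) :
    IsConnected (wiredSubgraph T S F) ↔ ∀ a ∈ nbhd T S, ∃ p ∈ nbhd T S \ S, Reach F a p := by
  have hadj : ∀ x y, (wiredSubgraph T S F).Adj x y →
      ∃ c d, s(c, d) ∈ F ∧ merge (S : Set V) c = x ∧ merge (S : Set V) d = y := by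
    rintro x y ⟨e, h⟩
    obtain ⟨c, d, rfl, h1, h2, h3⟩ := (isLink_wiredSubgraph hF).1 h
    exact ⟨c, d, h1, h2, h3⟩
  have hvert : ∀ x, x ∈ (wiredSubgraph T S F).vertexSet ↔
      ∃ a ∈ nbhd T S, merge (S : Set V) a = x := by
    intro x
    change x ∈ merge (S : Set V) '' withNeighbours T (S : Set V) ↔ _
    rw [← coe_nbhd]
    simp
  constructor
  · intro hc a ha
    obtain ⟨q, hq⟩ := hne
    rw [Finset.mem_sdiff] at hq
    have hp : ∃ p, p ∉ S ∧ Reach F a p := by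
      rcases reach_of_wired hadj (hc _ ((hvert _).2 ⟨a, ha, rfl⟩) _ ((hvert _).2 ⟨q, hq.1, rfl⟩))
        with ⟨c, h1, h2⟩ | h
      · rcases eq_or_notMem_of_merge_eq h2 with rfl | ⟨h, -⟩
        exacts [⟨c, hq.2, h1⟩, ⟨c, h, h1⟩]
      · exact h
    obtain ⟨p, hpS, hp⟩ := hp
    exact ⟨p, Finset.mem_sdiff.2 ⟨hp.mem hF ha, hpS⟩, hp⟩
  · intro h x hx y hy
    have hnone : ∀ x ∈ (wiredSubgraph T S F).vertexSet,
        Relation.ReflTransGen (wiredSubgraph T S F).Adj x none := by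
      intro x hx
      obtain ⟨a, ha, rfl⟩ := (hvert x).1 hx
      obtain ⟨p, hp, hap⟩ := h a ha
      rw [← merge_of_notMem (Finset.mem_sdiff.1 hp).2]
      exact Relation.ReflTransGen.lift (merge (S : Set V))
        (fun b c hbc ↦ ⟨s(b, c), (isLink_wiredSubgraph hF).2 ⟨b, c, rfl, hbc, rfl, rfl⟩⟩) _ _ hap
    have : Std.Symm (wiredSubgraph T S F).Adj := ⟨fun _ _ h ↦ h.symm⟩
    exact (hnone x hx).trans (Relation.ReflTransGen.stdSymm.symm _ _ (hnone y hy))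

end Wired

/-! ### The gas on the wired graph as a Gibbs sum -/

section Cylinder

variable {V : Type*} [DecidableEq V] {T : SimpleGraph V} {J J' : Finset (Sym2 V)}

open Classical in
/-- The state of any pair of vertices: the pairs that are not edges of `T` are closed. -/
noncomputable def extendConfig (ω : Config T) (e : Sym2 V) : Bool :=
  if h : e ∈ T.edgeSet then ω ⟨e, h⟩ else false

/-- The open edges of a configuration in the finite set `J`. -/
noncomputable def openIn (J : Finset (Sym2 V)) (ω : Config T) : Finset (Sym2 V) :=
  J.filter fun e ↦ extendConfig ω e = true

theorem openIn_inter (h : J ⊆ J') (ω : Config T) : openIn J' ω ∩ J = openIn J ω := by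
  ext e
  simp only [openIn, Finset.mem_inter, Finset.mem_filter]
  exact ⟨fun ⟨⟨_, h1⟩, h2⟩ ↦ ⟨h2, h1⟩, fun ⟨h1, h2⟩ ↦ ⟨⟨h h1, h2⟩, h1⟩⟩

theorem continuous_openIn {X : Type*} [TopologicalSpace X] (J : Finset (Sym2 V))
    (g : Finset (Sym2 V) → X) : Continuous fun ω : Config T ↦ g (openIn J ω) := by
  classical
  have h1 : Continuous fun (ω : Config T) (e : J) ↦ extendConfig ω e := by
    refine continuous_pi fun e ↦ ?_
    by_cases h : (e : Sym2 V) ∈ T.edgeSet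
    · simpa [extendConfig, h] using continuous_apply (⟨e, h⟩ : T.edgeSet)
    · simpa [extendConfig, h] using continuous_const
  have h2 : Continuous fun c : J → Bool ↦
      g (J.filter fun e ↦ ∃ h : e ∈ J, c ⟨e, h⟩ = true) := continuous_of_discreteTopology
  convert h2.comp h1 using 2 with ω
  refine congrArg g (Finset.filter_congr fun e he ↦ ?_)
  simp [he]

end Cylinder

section FiniteGas

variable {V : Type*} [DecidableEq V] {T : SimpleGraph V} [T.LocallyFinite] {S : Finset V} {o : V}
  {t : ℝ}

theorem edgeSet_wiredGraph : (wiredGraph T (S : Set V)).edgeSet = edgesIn T (nbhd T S) := by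
  ext e
  change (∃ x y, (e = s(x, y) ∧ e ∈ T.edgeSet) ∧ x ∈ withNeighbours T (S : Set V) ∧
    y ∈ withNeighbours T (S : Set V)) ↔ _
  rw [← coe_nbhd]
  constructor
  · rintro ⟨x, y, ⟨rfl, h⟩, hx, hy⟩
    exact mem_edgesIn.2 ⟨hx, hy, h⟩
  · intro h
    induction e with
    | h x y =>
      obtain ⟨hx, hy, hxy⟩ := mem_edgesIn.1 h
      exact ⟨x, y, ⟨rfl, hxy⟩, hx, hy⟩

instance : Finite (wiredGraph T (S : Set V)).edgeSet := by
  rw [edgeSet_wiredGraph]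
  infer_instance

theorem mem_edgeSet_wiredGraph {e : Sym2 V} :
    e ∈ (wiredGraph T (S : Set V)).edgeSet ↔ e ∈ edgesIn T (nbhd T S) := by
  rw [edgeSet_wiredGraph, Finset.mem_coe]

open Classical in
/-- The open edges of a configuration on the wired graph. -/
noncomputable def wiredOpen (ω : (wiredGraph T (S : Set V)).edgeSet → Bool) : Finset (Sym2 V) :=
  (edgesIn T (nbhd T S)).filter fun e ↦
    e ∈ openEdges (wiredGraph T (S : Set V)) ω

theorem mem_wiredOpen {ω : (wiredGraph T (S : Set V)).edgeSet → Bool} {e : Sym2 V} :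
    e ∈ wiredOpen ω ↔ e ∈ edgesIn T (nbhd T S) ∧ ∃ h, ω ⟨e, h⟩ = true := by
  classical
  exact Finset.mem_filter

theorem wiredOpen_subset (ω : (wiredGraph T (S : Set V)).edgeSet → Bool) :
    wiredOpen ω ⊆ edgesIn T (nbhd T S) := fun _ h ↦ (mem_wiredOpen.1 h).1

theorem coe_wiredOpen (ω : (wiredGraph T (S : Set V)).edgeSet → Bool) :
    (wiredOpen ω : Set (Sym2 V)) = openEdges (wiredGraph T (S : Set V)) ω := by
  ext e
  simp only [wiredOpen, Finset.coe_filter, Set.mem_ofPred_eq, and_iff_right_iff_imp]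
  rintro ⟨h, -⟩
  exact mem_edgeSet_wiredGraph.1 h

theorem openIn_closedExtension (ω : (wiredGraph T (S : Set V)).edgeSet → Bool) :
    openIn (edgesIn T (nbhd T S)) (closedExtension T (S : Set V) ω) = wiredOpen ω := by
  classical
  refine Finset.filter_congr fun e he ↦ ?_
  have h1 : e ∈ T.edgeSet := edgesIn_subset_edgeSet he
  have h2 : e ∈ (wiredGraph T (S : Set V)).edgeSet := mem_edgeSet_wiredGraph.2 he
  simp [openEdges, extendConfig, h1, closedExtension, h2]

/-- Sums over the configurations on the wired graph are sums over sets of edges. -/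
theorem sum_wiredOpen [Fintype ((wiredGraph T (S : Set V)).edgeSet → Bool)]
    (φ : Finset (Sym2 V) → ℝ) :
    ∑ ω : (wiredGraph T (S : Set V)).edgeSet → Bool, φ (wiredOpen ω) =
      ∑ F ∈ (edgesIn T (nbhd T S)).powerset, φ F := by
  classical
  refine Finset.sum_bij' (fun ω _ ↦ wiredOpen ω) (fun F _ e ↦ decide ((e : Sym2 V) ∈ F))
    (fun ω _ ↦ Finset.mem_powerset.2 (wiredOpen_subset ω)) (fun _ _ ↦ Finset.mem_univ _) ?_ ?_
    fun _ _ ↦ rfl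
  · intro ω _
    funext e
    have he : (e : Sym2 V) ∈ edgesIn T (nbhd T S) := mem_edgeSet_wiredGraph.1 e.2
    have : (e : Sym2 V) ∈ wiredOpen ω ↔ ω e = true :=
      mem_wiredOpen.trans ⟨fun ⟨_, _, h⟩ ↦ h, fun h ↦ ⟨he, e.2, h⟩⟩
    simp [this]
  · intro F hF
    ext e
    simp only [mem_wiredOpen, decide_eq_true_eq]
    constructor
    · rintro ⟨-, -, h⟩
      exact h
    · intro h
      have := Finset.mem_powerset.1 hF h
      exact ⟨this, mem_edgeSet_wiredGraph.2 this, h⟩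

open Classical in
/-- The weight of a set of edges of the wired graph, with `t = 1 / β`. -/
noncomputable def wiredWeight (T : SimpleGraph V) [T.LocallyFinite] (t : ℝ) (S : Finset V)
    (F : Finset (Sym2 V)) : ℝ :=
  if Separated F (nbhd T S \ S) then
    t ^ ((nbhd T S).card - F.card - (nbhd T S \ S).card) else 0

/-- The boundary weights of the wired graph: exactly the vertices outside `S` are joined to the
boundary. -/
theorem gibbs_wired (g : Finset (Sym2 V) → ℝ) :
    gibbs T t (fun v ↦ if v ∈ S then 1 else 0) (fun v ↦ if v ∈ S then 0 else 1) (nbhd T S)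
      (fun F _ ↦ g F) = ∑ F ∈ (edgesIn T (nbhd T S)).powerset, wiredWeight T t S F * g F := by
  refine Finset.sum_congr rfl fun F _ ↦ ?_
  rw [Finset.sum_eq_single (nbhd T S \ S)]
  · congr 1
    unfold gibbsWeight wiredWeight
    have : ∏ v ∈ nbhd T S, (if v ∈ nbhd T S \ S then (if v ∈ S then (0 : ℝ) else 1)
        else if v ∈ S then 1 else 0) = 1 := by
      refine Finset.prod_eq_one fun v hv ↦ ?_
      by_cases h : v ∈ S <;> simp [hv, h]
    rw [this, mul_one]
  · intro P hP hne
    have : ∃ v ∈ nbhd T S, ¬ (v ∈ P ↔ v ∉ S) := by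
      by_contra! hcon
      refine hne (Finset.ext fun v ↦ ?_)
      rw [Finset.mem_sdiff]
      constructor
      · intro hv
        have hN := Finset.mem_powerset.1 hP hv
        exact ⟨hN, (hcon v hN).1 hv⟩
      · exact fun ⟨h1, h2⟩ ↦ (hcon v h1).2 h2
    obtain ⟨v, hv, h⟩ := this
    have h0 : ∏ v ∈ nbhd T S, (if v ∈ P then (if v ∈ S then (0 : ℝ) else 1)
        else if v ∈ S then 1 else 0) = 0 := by
      refine Finset.prod_eq_zero hv ?_
      by_cases h1 : v ∈ P <;> by_cases h2 : v ∈ S <;> simp_all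
    unfold gibbsWeight
    rw [h0]
    simp
  · exact fun h ↦ (h (Finset.mem_powerset.2 Finset.sdiff_subset)).elim

theorem isForest_iff (hT : T.IsAcyclic) (hS : (T.induce (S : Set V)).Connected)
    (ω : (wiredGraph T (S : Set V)).edgeSet → Bool) :
    IsForest (wiredGraph T (S : Set V)) ω ↔ Separated (wiredOpen ω) (nbhd T S \ S) := by
  rw [IsForest, ← coe_wiredOpen]
  exact isAcyclic_wiredSubgraph_iff hT hS (wiredOpen_subset ω)

/-- A forest of the wired graph is a spanning tree if and only if no cluster misses the boundary. -/
theorem isSpanningTree_iff (hT : T.IsAcyclic) (hS : (T.induce (S : Set V)).Connected)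
    (hN : Grow T {o} (nbhd T S)) (hne : (nbhd T S \ S).Nonempty)
    (ω : (wiredGraph T (S : Set V)).edgeSet → Bool) :
    IsSpanningTree (wiredGraph T (S : Set V)) ω ↔ Separated (wiredOpen ω) (nbhd T S \ S) ∧
      (nbhd T S).card - (wiredOpen ω).card - (nbhd T S \ S).card = 0 := by
  rw [IsSpanningTree, isForest_iff hT hS]
  refine and_congr_right fun hs ↦ ?_
  obtain ⟨h1, h2⟩ := hs.card_le hN (wiredOpen_subset ω) Finset.sdiff_subset
  rw [← coe_wiredOpen]
  refine (isConnected_wiredSubgraph_iff (wiredOpen_subset ω) hne).trans (h2.symm.trans ?_)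
  omega

/-- The arboreal gas (the uniform spanning tree if `β = ∞`) on the wired graph, before its
configurations are seen as configurations on the edges of `T`. -/
noncomputable def wiredLaw (T : SimpleGraph V) (β : ℝ≥0∞) (S : Finset V) :
    Measure ((wiredGraph T (S : Set V)).edgeSet → Bool) :=
  open Classical in
  if β = ∞ then uniformSpanningTree (wiredGraph T (S : Set V))
  else arborealGas (wiredGraph T (S : Set V)) β

omit [DecidableEq V] [T.LocallyFinite] in
theorem finiteGas_eq_map (β : ℝ≥0∞) :
    finiteGas T β (S : Set V) = (wiredLaw T β S).map (closedExtension T (S : Set V)) := by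
  unfold finiteGas wiredLaw
  split_ifs <;> rfl

/-- The probability of a configuration is proportional to its weight, also for `β = ∞`: then
`t = 0`, and only the forests with a single tree have positive weight. -/
theorem wiredLaw_singleton (hT : T.IsAcyclic) (hS : (T.induce (S : Set V)).Connected)
    (hN : Grow T {o} (nbhd T S)) (hne : (nbhd T S \ S).Nonempty) {β : ℝ≥0∞} (hβ : 0 < β)
    (ω : (wiredGraph T (S : Set V)).edgeSet → Bool) :
    (wiredLaw T β S).real {ω} = wiredWeight T (β⁻¹).toReal S (wiredOpen ω) /
      ∑ F ∈ (edgesIn T (nbhd T S)).powerset, wiredWeight T (β⁻¹).toReal S F := by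
  classical
  have := Fintype.ofFinite ((wiredGraph T (S : Set V)).edgeSet → Bool)
  rw [← sum_wiredOpen]
  unfold wiredLaw
  by_cases hβ' : β = ∞
  · subst hβ'
    have hw : ∀ ω, wiredWeight T ((∞ : ℝ≥0∞)⁻¹).toReal S (wiredOpen ω) =
        if IsSpanningTree (wiredGraph T (S : Set V)) ω then 1 else 0 := by
      intro ω
      rw [ENNReal.inv_top, ENNReal.toReal_zero, wiredWeight]
      by_cases h : IsSpanningTree (wiredGraph T (S : Set V)) ω
      · rw [if_pos h]
        rw [isSpanningTree_iff hT hS hN hne] at h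
        rw [if_pos h.1, h.2, pow_zero]
      · rw [if_neg h]
        rw [isSpanningTree_iff hT hS hN hne, not_and] at h
        split_ifs with h'
        · exact zero_pow (h h')
        · rfl
    simp only [hw, if_true]
    rw [Finset.sum_boole, uniformSpanningTree, uniformOn, measureReal_def,
      cond_apply (MeasurableSet.of_discrete), ENNReal.toReal_mul, ENNReal.toReal_inv]
    have h1 : (Measure.count {ω | IsSpanningTree (wiredGraph T (S : Set V)) ω}).toReal =
        ((Finset.univ.filter fun ω ↦ IsSpanningTree (wiredGraph T (S : Set V)) ω).card : ℝ) := by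
      rw [show {ω | IsSpanningTree (wiredGraph T (S : Set V)) ω} =
        ((Finset.univ.filter fun ω ↦ IsSpanningTree (wiredGraph T (S : Set V)) ω : Finset _) :
          Set _) by ext; simp, Measure.count_apply_finset]
      simp
    rw [h1]
    by_cases h : IsSpanningTree (wiredGraph T (S : Set V)) ω
    · have : {ω | IsSpanningTree (wiredGraph T (S : Set V)) ω} ∩ {ω} = {ω} := by
        ext; simp +contextual [h]
      rw [this, if_pos h]
      simp
    · have : {ω | IsSpanningTree (wiredGraph T (S : Set V)) ω} ∩ {ω} = ∅ := by
        ext ω'; simp only [Set.mem_inter_iff, Set.mem_ofPred_eq, Set.mem_singleton_iff,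
          Set.mem_empty_iff_false, iff_false, not_and]
        rintro h' rfl
        exact h h'
      rw [this, if_neg h]
      simp
  · rw [if_neg hβ']
    obtain ⟨n, hn⟩ : ∃ n, (nbhd T S).card = n + (nbhd T S \ S).card :=
      ⟨(nbhd T S).card - (nbhd T S \ S).card, by
        have := Finset.card_le_card (Finset.sdiff_subset : nbhd T S \ S ⊆ nbhd T S)
        omega⟩
    have hb : 0 < β.toReal := ENNReal.toReal_pos hβ.ne' hβ'
    have hw : ∀ ω, (forestWeight (wiredGraph T (S : Set V)) β ω).toReal =
        β.toReal ^ n * wiredWeight T (β⁻¹).toReal S (wiredOpen ω) := by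
      intro ω
      unfold forestWeight wiredWeight
      rw [isForest_iff hT hS]
      by_cases hs : Separated (wiredOpen ω) (nbhd T S \ S)
      · obtain ⟨h1, -⟩ := hs.card_le hN (wiredOpen_subset ω) Finset.sdiff_subset
        rw [if_pos hs, if_pos hs, ← coe_wiredOpen, Set.ncard_coe_finset, ENNReal.toReal_pow,
          ENNReal.toReal_inv]
        have e1 : (nbhd T S).card - (wiredOpen ω).card - (nbhd T S \ S).card =
          n - (wiredOpen ω).card := by omega
        have e2 : n = (n - (wiredOpen ω).card) + (wiredOpen ω).card := by omega
        rw [e1]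
        conv_rhs => rw [e2]
        rw [pow_add, Nat.add_sub_cancel, mul_right_comm, ← mul_pow, mul_inv_cancel₀ hb.ne',
          one_pow, one_mul]
      · rw [if_neg hs, if_neg hs]
        simp
    have htop : ∀ ω, forestWeight (wiredGraph T (S : Set V)) β ω ≠ ∞ := by
      intro ω
      unfold forestWeight
      split_ifs
      · exact ENNReal.pow_ne_top hβ'
      · exact ENNReal.zero_ne_top
    have hmass : (Measure.sum fun ω' ↦ forestWeight (wiredGraph T (S : Set V)) β ω' •
        Measure.dirac ω') {ω} = forestWeight (wiredGraph T (S : Set V)) β ω := by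
      rw [Measure.sum_apply _ (MeasurableSet.of_discrete), tsum_eq_single ω]
      · simp
      · intro ω' hne'
        simp [hne']
    rw [arborealGas, measureReal_def, Measure.smul_apply, hmass, smul_eq_mul, ENNReal.toReal_mul,
      ENNReal.toReal_inv, tsum_fintype, ENNReal.toReal_sum fun ω _ ↦ htop ω]
    simp only [hw]
    rw [← Finset.mul_sum, inv_mul_eq_div, mul_div_mul_left _ _ (pow_pos hb n).ne']

instance (β : ℝ≥0∞) : IsFiniteMeasure (wiredLaw T β S) := by
  unfold wiredLaw
  split_ifs
  · unfold uniformSpanningTree uniformOn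
    infer_instance
  · refine ⟨?_⟩
    rw [arborealGas, Measure.smul_apply, Measure.sum_apply _ MeasurableSet.univ]
    simp only [Measure.smul_apply, measure_univ, smul_eq_mul, mul_one]
    exact (ENNReal.inv_mul_le_one _).trans_lt ENNReal.one_lt_top

/-- The expectation of a function of finitely many edges under the gas on the wired graph. -/
theorem integral_finiteGas [Countable V] (hT : T.IsAcyclic) (hS : (T.induce (S : Set V)).Connected)
    (hN : Grow T {o} (nbhd T S)) (hne : (nbhd T S \ S).Nonempty) {β : ℝ≥0∞} (hβ : 0 < β)
    {A : Finset V} (hA : A ⊆ nbhd T S) (g : Finset (Sym2 V) → ℝ) :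
    ∫ ω, g (openIn (edgesIn T A) ω) ∂(finiteGas T β (S : Set V)) =
      gibbs T (β⁻¹).toReal (fun v ↦ if v ∈ S then 1 else 0) (fun v ↦ if v ∈ S then 0 else 1)
          (nbhd T S) (fun F _ ↦ g (F ∩ edgesIn T A)) /
        gibbs T (β⁻¹).toReal (fun v ↦ if v ∈ S then 1 else 0) (fun v ↦ if v ∈ S then 0 else 1)
          (nbhd T S) (fun _ _ ↦ 1) := by
  classical
  have := Fintype.ofFinite ((wiredGraph T (S : Set V)).edgeSet → Bool)
  rw [finiteGas_eq_map, integral_map (measurable_of_finite _).aemeasurable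
    (continuous_openIn _ _).aestronglyMeasurable, integral_fintype .of_finite]
  simp only [wiredLaw_singleton hT hS hN hne hβ, smul_eq_mul, ← openIn_inter (edgesIn_mono hA),
    openIn_closedExtension]
  rw [sum_wiredOpen (fun F ↦ wiredWeight T (β⁻¹).toReal S F /
    (∑ F ∈ (edgesIn T (nbhd T S)).powerset, wiredWeight T (β⁻¹).toReal S F) *
      g (F ∩ edgesIn T A)), gibbs_wired, gibbs_wired, Finset.sum_div]
  refine Finset.sum_congr rfl fun F _ ↦ ?_
  simp only [mul_one]
  ring

theorem isProbabilityMeasure_finiteGas [Countable V] (hT : T.IsAcyclic)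
    (hS : (T.induce (S : Set V)).Connected)
    (hN : Grow T {o} (nbhd T S)) (hne : (nbhd T S \ S).Nonempty) {β : ℝ≥0∞} (hβ : 0 < β)
    (hZ : gibbs T (β⁻¹).toReal (fun v ↦ if v ∈ S then 1 else 0) (fun v ↦ if v ∈ S then 0 else 1)
      (nbhd T S) (fun _ _ ↦ 1) ≠ 0) :
    IsProbabilityMeasure (finiteGas T β (S : Set V)) := by
  have h := integral_finiteGas hT hS hN hne hβ subset_nbhd (fun _ ↦ 1)
  rw [div_self hZ, integral_const, smul_eq_mul, mul_one, measureReal_def] at h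
  exact ⟨by rw [← ENNReal.ofReal_toReal (a := finiteGas T β (S : Set V) Set.univ), h]
            · simp
            · intro h'; simp [h'] at h⟩

end FiniteGas

/-! ### Convergence of the boundary weights -/

section UpperWeight

variable {k : ℕ} {t : ℝ}

/-- The effective weight of a branch of depth `n` of the `k`-regular tree that is wired at its end,
seen through the edge at its root. -/
noncomputable def upperWeight (k : ℕ) (t : ℝ) : ℕ → ℝ
  | 0 => 1
  | n + 1 => (k - 1) * upperWeight k t n / (1 + t + (k - 1) * upperWeight k t n)

theorem branchWeight_eq (hk : 3 ≤ k) :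
    branchWeight k t * (1 + t + (k - 1) * branchWeight k t) = (k - 1) * branchWeight k t := by
  rw [mul_comm]
  exact leafWeight_mul_branchWeight hk

theorem branchWeight_le_upperWeight (hk : 3 ≤ k) (ht : 0 ≤ t) (n : ℕ) :
    branchWeight k t ≤ upperWeight k t n := by
  have hk1 : (0 : ℝ) < k - 1 := by
    have : (3 : ℝ) ≤ k := by exact_mod_cast hk
    linarith
  have h0 := branchWeight_nonneg (k := k) (t := t)
  have h1 := branchWeight_le_one hk ht
  have h2 := branchWeight_eq (t := t) hk
  induction n with
  | zero => exact h1
  | succ n ih =>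
    rw [upperWeight, le_div_iff₀ (by nlinarith [mul_nonneg hk1.le (h0.trans ih)])]
    have := mul_nonneg (mul_nonneg hk1.le (sub_nonneg.2 ih)) (sub_nonneg.2 h1)
    linarith

theorem upperWeight_nonneg (hk : 3 ≤ k) (ht : 0 ≤ t) (n : ℕ) : 0 ≤ upperWeight k t n :=
  branchWeight_nonneg.trans (branchWeight_le_upperWeight hk ht n)

theorem upperWeight_denom_pos (hk : 3 ≤ k) (ht : 0 ≤ t) (n : ℕ) :
    0 < 1 + t + (k - 1) * upperWeight k t n := by
  have hk1 : (0 : ℝ) < k - 1 := by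
    have : (3 : ℝ) ≤ k := by exact_mod_cast hk
    linarith
  have := mul_nonneg hk1.le (upperWeight_nonneg hk ht n)
  linarith

theorem upperWeight_succ_mul (hk : 3 ≤ k) (ht : 0 ≤ t) (n : ℕ) :
    upperWeight k t (n + 1) * (1 + t + (k - 1) * upperWeight k t n) =
      (k - 1) * upperWeight k t n := by
  rw [upperWeight, div_mul_cancel₀ _ (upperWeight_denom_pos hk ht n).ne']

theorem upperWeight_succ_le (hk : 3 ≤ k) (ht : 0 ≤ t) (n : ℕ) :
    upperWeight k t (n + 1) ≤ upperWeight k t n := by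
  have hk1 : (0 : ℝ) < k - 1 := by
    have : (3 : ℝ) ≤ k := by exact_mod_cast hk
    linarith
  induction n with
  | zero =>
    refine le_of_mul_le_mul_right ?_ (upperWeight_denom_pos hk ht 0)
    rw [upperWeight_succ_mul hk ht, upperWeight]
    linarith
  | succ n ih =>
    rw [upperWeight, div_le_iff₀ (upperWeight_denom_pos hk ht _)]
    have h1 := upperWeight_succ_mul hk ht n
    have h2 : (k - 1) * upperWeight k t (n + 1) ≤ (k - 1) * upperWeight k t n :=
      mul_le_mul_of_nonneg_left ih hk1.le
    have h3 : 0 ≤ 1 - upperWeight k t (n + 1) := by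
      rw [upperWeight, sub_nonneg, div_le_one (upperWeight_denom_pos hk ht n)]
      linarith
    have := mul_nonneg h3 (sub_nonneg.2 h2)
    linarith

theorem upperWeight_anti (hk : 3 ≤ k) (ht : 0 ≤ t) : Antitone (upperWeight k t) :=
  antitone_nat_of_succ_le (upperWeight_succ_le hk ht)

theorem upperWeight_le_one (hk : 3 ≤ k) (ht : 0 ≤ t) (n : ℕ) : upperWeight k t n ≤ 1 :=
  upperWeight_anti hk ht (Nat.zero_le n)

theorem tendsto_upperWeight (hk : 3 ≤ k) (ht : 0 ≤ t) :
    Tendsto (upperWeight k t) atTop (𝓝 (branchWeight k t)) := by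
  have hk1 : (0 : ℝ) < k - 1 := by
    have : (3 : ℝ) ≤ k := by exact_mod_cast hk
    linarith
  have hbdd : BddBelow (Set.range (upperWeight k t)) :=
    ⟨_, Set.forall_mem_range.2 (branchWeight_le_upperWeight hk ht)⟩
  have hlim := tendsto_atTop_ciInf (upperWeight_anti hk ht) hbdd
  set L := ⨅ n, upperWeight k t n
  have hL : branchWeight k t ≤ L := le_ciInf (branchWeight_le_upperWeight hk ht)
  have hfix : L * (1 + t + (k - 1) * L) = (k - 1) * L := by
    refine tendsto_nhds_unique (f := fun n ↦ upperWeight k t (n + 1) *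
      (1 + t + (k - 1) * upperWeight k t n)) (l := atTop) ?_ ?_
    · exact ((tendsto_add_atTop_iff_nat 1).2 hlim).mul ((hlim.const_mul _).const_add _)
    · simp only [upperWeight_succ_mul hk ht]
      exact hlim.const_mul _
  -- `branchWeight` is the largest fixed point
  have hL' : L ≤ branchWeight k t := by
    rcases eq_or_ne L 0 with h0 | h0
    · rw [h0]
      exact branchWeight_nonneg
    · refine le_max_of_le_right ?_
      rw [le_div_iff₀ hk1]
      have : 1 + t + (k - 1) * L = k - 1 := by
        refine mul_left_cancel₀ h0 ?_
        rw [hfix]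
        ring
      linarith
  rwa [le_antisymm hL hL']

end UpperWeight

section Convergence

variable {V : Type*} [DecidableEq V] {T : SimpleGraph V} [T.LocallyFinite] {t : ℝ} {k : ℕ}
  {A B S C : Finset V} {u v w o : V} {a b : V → ℝ}

/-- The boundary weights `b v / a v` on `C` lie between `d * l` and `d * H v`, where `d` is the
number of neighbours of `v` outside `A`. -/
def WeightBounds (T : SimpleGraph V) [T.LocallyFinite] (l : ℝ) (A C : Finset V) (H a b : V → ℝ) :
    Prop :=
  ∀ v ∈ C, 0 < a v ∧ outDeg T A v * l * a v ≤ b v ∧ b v ≤ outDeg T A v * H v * a v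

/-- Removing a leaf `v` whose branch has effective weight between `l` and `h` preserves the bounds on
the boundary weights. -/
theorem exists_gibbs_prune (hB : Grow T {o} B) (hl : IsLeaf T B u v) (hC : C ⊆ B) {l h : ℝ}
    {H : V → ℝ} (hab : WeightBounds T l (insert v B) C H a b)
    (hD : 0 < (1 + t) * a v + b v) (hlow : l * ((1 + t) * a v + b v) ≤ b v)
    (hup : b v ≤ h * ((1 + t) * a v + b v)) (hH : h ≤ H u) :
    ∃ a' b' : V → ℝ, WeightBounds T l B C H a' b' ∧
      (∀ w, w ≠ u → a' w = a w ∧ b' w = b w) ∧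
      ∀ g : Finset (Sym2 V) → ℝ,
        gibbs T t a b (insert v B) (fun F _ ↦ g (F ∩ edgesIn T B)) =
          gibbs T t a' b' B (fun F _ ↦ g (F ∩ edgesIn T B)) := by
  refine ⟨_, _, fun w hw ↦ ?_, fun w hw ↦ ?_, fun g ↦ gibbs_insert_of_edges hB hl g⟩
  · obtain ⟨h1, h2, h3⟩ := hab w hw
    rcases eq_or_ne w u with rfl | hne
    · have hd : (outDeg T B w : ℝ) = outDeg T (insert v B) w + 1 := by
        rw [hl.outDeg_parent]; push_cast; ring
      simp only [Function.update_self, hd]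
      set D := (1 + t) * a v + b v
      refine ⟨mul_pos h1 hD, ?_, ?_⟩
      · linarith [mul_le_mul_of_nonneg_right h2 hD.le, mul_le_mul_of_nonneg_left hlow h1.le]
      · linarith [mul_le_mul_of_nonneg_right h3 hD.le, mul_le_mul_of_nonneg_left hup h1.le,
          mul_le_mul_of_nonneg_right hH (mul_nonneg h1.le hD.le)]
    · simp only [Function.update_of_ne hne]
      rw [← hl.outDeg_other (hC hw) hne]
      exact ⟨h1, h2, h3⟩
  · simp [Function.update_of_ne hw]

/-- Restriction of the gas on the wired graph of `S` to the edges inside `S`. -/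
theorem exists_gibbs_interior {l : ℝ} (hl1 : l ≤ 1) (hS : Grow T {o} S)
    (hSB : Grow T S B) (hBN : B ⊆ nbhd T S)
    (hab : WeightBounds T l B S (fun _ ↦ 1) a b) (hbd : ∀ v ∈ B, v ∉ S → a v = 0 ∧ b v = 1) :
    ∃ a' b' : V → ℝ, WeightBounds T l S S (fun _ ↦ 1) a' b' ∧ ∀ g : Finset (Sym2 V) → ℝ,
      gibbs T t a b B (fun F _ ↦ g (F ∩ edgesIn T S)) =
        gibbs T t a' b' S (fun F _ ↦ g (F ∩ edgesIn T S)) := by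
  induction hSB generalizing a b with
  | refl => exact ⟨a, b, hab, fun _ ↦ rfl⟩
  | @step B u v hB hl ih =>
    have hvS : v ∉ S := fun h ↦ hl.notMem (hB.subset h)
    obtain ⟨ha, hb⟩ := hbd v (Finset.mem_insert_self _ _) hvS
    have huS : u ∈ S := by
      obtain ⟨s, hs, hsv⟩ := (mem_nbhd.1 (hBN (Finset.mem_insert_self _ _))).resolve_left hvS
      rwa [← hl.unique s (hB.subset hs) hsv]
    obtain ⟨a', b', h1, h2, h3⟩ := exists_gibbs_prune (t := t) (hS.trans hB) hl hB.subset hab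
      (h := 1) (by simp [ha, hb]) (by simpa [ha, hb] using hl1) (by simp [ha]) le_rfl
    obtain ⟨a'', b'', h4, h5⟩ := ih ((Finset.subset_insert _ _).trans hBN) h1 fun w hw hwS ↦ by
      have hwu : w ≠ u := fun h ↦ hwS (h ▸ huS)
      rw [(h2 w hwu).1, (h2 w hwu).2]
      exact hbd w (Finset.mem_insert_of_mem hw) hwS
    refine ⟨a'', b'', h4, fun g ↦ ?_⟩
    rw [← h5]
    have := h3 fun F ↦ g (F ∩ edgesIn T S)
    simpa only [Finset.inter_assoc, Finset.inter_eq_right.2 (edgesIn_mono hB.subset)] using this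

/-- Restriction of a Gibbs sum to a smaller set: one more layer of leaves improves the upper bound
`h` on the weights of the branches to `h'`. -/
theorem exists_gibbs_shrink (hk : 3 ≤ k) (ht : 0 ≤ t) (hreg : T.IsRegularOfDegree k) {h h' : ℝ}
    (hh : (k - 1) * h ≤ h' * (1 + t + (k - 1) * h)) (hle : h' ≤ h) (hh1 : h' ≤ 1)
    (hA : Grow T {o} A) (hAB : Grow T A B)
    (hab : WeightBounds T (branchWeight k t) B B (fun v ↦ if v ∈ A then h' else h) a b) :
    ∃ a' b' : V → ℝ, WeightBounds T (branchWeight k t) A A (fun _ ↦ h') a' b' ∧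
      ∀ g : Finset (Sym2 V) → ℝ, gibbs T t a b B (fun F _ ↦ g (F ∩ edgesIn T A)) =
        gibbs T t a' b' A (fun F _ ↦ g (F ∩ edgesIn T A)) := by
  induction hAB generalizing a b with
  | refl => exact ⟨a, b, fun v hv ↦ by simpa [hv] using hab v hv, fun _ ↦ rfl⟩
  | @step B u v hB hl ih =>
    have hvA : v ∉ A := fun h ↦ hl.notMem (hB.subset h)
    obtain ⟨h1, h2, h3⟩ := hab v (Finset.mem_insert_self _ _)
    have hd : (outDeg T (insert v B) v : ℝ) = k - 1 := by
      rw [← hl.outDeg_leaf hreg]; push_cast; ring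
    rw [hd] at h2 h3
    simp only [hvA, if_false] at h3
    have hk1 : (0 : ℝ) < k - 1 := by
      have : (3 : ℝ) ≤ k := by exact_mod_cast hk
      linarith
    have hx := branchWeight_nonneg (k := k) (t := t)
    have hx1 := branchWeight_le_one hk ht
    have hfix := branchWeight_eq (t := t) hk
    have hb0 : 0 ≤ b v := le_trans (by positivity) h2
    have hD : 0 < (1 + t) * a v + b v := by positivity
    have hlow : branchWeight k t * ((1 + t) * a v + b v) ≤ b v := by
      have e1 := mul_le_mul_of_nonneg_left h2 (sub_nonneg.2 hx1)
      have e2 : a v * (branchWeight k t * (1 + t + (k - 1) * branchWeight k t)) =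
        a v * ((k - 1) * branchWeight k t) := by rw [hfix]
      linarith
    have hup : b v ≤ h' * ((1 + t) * a v + b v) := by
      have e1 := mul_le_mul_of_nonneg_left h3 (sub_nonneg.2 hh1)
      have e2 := mul_le_mul_of_nonneg_left hh h1.le
      linarith
    obtain ⟨a', b', h4, -, h5⟩ := exists_gibbs_prune (t := t) (hA.trans hB) hl subset_rfl
      (fun w hw ↦ hab w (Finset.mem_insert_of_mem hw)) hD hlow hup
      (by split_ifs; exacts [le_rfl, hle])
    obtain ⟨a'', b'', h6, h7⟩ := ih h4
    refine ⟨a'', b'', h6, fun g ↦ ?_⟩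
    rw [← h7]
    have := h5 fun F ↦ g (F ∩ edgesIn T A)
    simpa only [Finset.inter_assoc, Finset.inter_eq_right.2 (edgesIn_mono hB.subset)] using this

/-- If `S` contains the `n`-neighbourhood of `A`, then the gas on the wired graph of `S`, restricted
to the edges inside `A`, has boundary weights between those of the infinite branch and those of the
wired branch of depth `n`. -/
theorem exists_gibbs_marginal (hT : T.IsAcyclic) (hk : 3 ≤ k) (ht : 0 ≤ t)
    (hreg : T.IsRegularOfDegree k) (hS : (T.induce (S : Set V)).Connected) (n : ℕ)
    (hA : (T.induce (A : Set V)).Connected) (hAS : (nbhd T)^[n] A ⊆ S) :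
    ∃ a b : V → ℝ,
      WeightBounds T (branchWeight k t) A A (fun _ ↦ upperWeight k t n) a b ∧
      ∀ g : Finset (Sym2 V) → ℝ,
        gibbs T t (fun v ↦ if v ∈ S then 1 else 0) (fun v ↦ if v ∈ S then 0 else 1) (nbhd T S)
            (fun F _ ↦ g (F ∩ edgesIn T A)) =
          gibbs T t a b A (fun F _ ↦ g (F ∩ edgesIn T A)) := by
  have hgrow : ∀ {A : Finset V}, (T.induce (A : Set V)).Connected → ∃ o, Grow T {o} A := by
    intro A hA
    obtain ⟨⟨o, ho⟩⟩ := hA.nonempty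
    exact ⟨o, grow_of_connected hT (by simpa using ho) (connected_singleton o) hA⟩
  obtain ⟨o, ho⟩ := hgrow hA
  have hk1 : (0 : ℝ) < k - 1 := by
    have : (3 : ℝ) ≤ k := by exact_mod_cast hk
    linarith
  induction n generalizing A o with
  | zero =>
    obtain ⟨p, hp⟩ := hgrow hS
    obtain ⟨a, b, h1, h2⟩ := exists_gibbs_interior (t := t)
      (a := fun v ↦ if v ∈ S then 1 else 0) (b := fun v ↦ if v ∈ S then 0 else 1)
      (branchWeight_le_one hk ht) hp (grow_nbhd hT hS) subset_rfl
      (fun v hv ↦ by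
        have : outDeg T (nbhd T S) v = 0 := by
          rw [outDeg, Finset.card_eq_zero, Finset.sdiff_eq_empty_iff_subset]
          intro w hw
          exact mem_nbhd.2 (Or.inr ⟨v, hv, by simpa using hw⟩)
        simp [hv, this])
      (fun v _ hv ↦ by simp [hv])
    obtain ⟨a', b', h3, h4⟩ := exists_gibbs_shrink (a := a) (b := b) (h := 1) (h' := 1) hk ht hreg
      (by linarith) le_rfl le_rfl ho (grow_of_connected hT hAS hA hS) (by simpa using h1)
    refine ⟨a', b', h3, fun g ↦ ?_⟩
    rw [← h4]
    have := h2 fun F ↦ g (F ∩ edgesIn T A)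
    simpa only [Finset.inter_assoc, Finset.inter_eq_right.2 (edgesIn_mono (show A ⊆ S from hAS))] using this
  | succ n ih =>
    rw [Function.iterate_succ_apply] at hAS
    have hg := grow_nbhd hT hA
    obtain ⟨a, b, h1, h2⟩ := ih (hg.connected hA) hAS o (ho.trans hg)
    obtain ⟨a', b', h3, h4⟩ := exists_gibbs_shrink (a := a) (b := b) hk ht hreg
      (upperWeight_succ_mul hk ht n).ge (upperWeight_succ_le hk ht n)
      (upperWeight_le_one hk ht _) ho hg (fun v hv ↦ by
        by_cases hvA : v ∈ A
        · have : outDeg T (nbhd T A) v = 0 := by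
            rw [outDeg, Finset.card_eq_zero, Finset.sdiff_eq_empty_iff_subset]
            intro w hw
            exact mem_nbhd.2 (Or.inr ⟨v, hvA, by simpa using hw⟩)
          simpa [this] using h1 v hv
        · simpa [hvA] using h1 v hv)
    refine ⟨a', b', h3, fun g ↦ ?_⟩
    rw [← h4]
    have := h2 fun F ↦ g (F ∩ edgesIn T A)
    simpa only [Finset.inter_assoc, Finset.inter_eq_right.2 (edgesIn_mono subset_nbhd)] using this

omit [T.LocallyFinite] in
/-- Only the ratios `b v / a v` matter, up to a constant factor. -/
theorem gibbs_normalize (ha : ∀ v ∈ A, 0 < a v) (f : Finset (Sym2 V) → Finset V → ℝ) :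
    gibbs T t a b A f = (∏ v ∈ A, a v) * gibbs T t (fun _ ↦ 1) (fun v ↦ b v / a v) A f := by
  simp only [gibbs, Finset.mul_sum]
  refine Finset.sum_congr rfl fun F _ ↦ Finset.sum_congr rfl fun P _ ↦ ?_
  have : ∏ v ∈ A, (if v ∈ P then b v else a v) =
      (∏ v ∈ A, a v) * ∏ v ∈ A, (if v ∈ P then b v / a v else 1) := by
    rw [← Finset.prod_mul_distrib]
    refine Finset.prod_congr rfl fun v hv ↦ ?_
    have := (ha v hv).ne'
    split_ifs
    · field_simp
    · simp
  unfold gibbsWeight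
  rw [this]
  split_ifs <;> ring

omit [T.LocallyFinite] in
theorem continuous_gibbs (f : Finset (Sym2 V) → Finset V → ℝ) :
    Continuous fun r : V → ℝ ↦ gibbs T t (fun _ ↦ 1) r A f := by
  refine continuous_finsetSum _ fun F _ ↦ continuous_finsetSum _ fun P _ ↦ ?_
  refine Continuous.mul ?_ continuous_const
  unfold gibbsWeight
  split_ifs
  · refine continuous_const.mul (continuous_finsetProd _ fun v _ ↦ ?_)
    split_ifs
    · exact continuous_apply v
    · exact continuous_const
  · exact continuous_const

/-- A finite set in the regular tree has a nonempty boundary: the leaf that was added last has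
`k - 1` neighbours outside. -/
theorem boundary_nonempty (hk : 3 ≤ k) (hreg : T.IsRegularOfDegree k)
    (hS : Grow T {o} S) : (nbhd T S \ S).Nonempty := by
  have hpos : ∃ v ∈ S, 0 < outDeg T S v := by
    cases hS with
    | refl =>
      refine ⟨o, by simp, ?_⟩
      rw [outDeg, Finset.sdiff_singleton_eq_erase, Finset.erase_eq_of_notMem (by simp),
        SimpleGraph.card_neighborFinset_eq_degree, hreg.degree_eq]
      omega
    | step hB hl =>
      have := hl.outDeg_leaf hreg
      exact ⟨_, Finset.mem_insert_self _ _, by omega⟩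
  obtain ⟨v, hv, hd⟩ := hpos
  obtain ⟨w, hw⟩ := Finset.card_pos.1 hd
  simp only [Finset.mem_sdiff, SimpleGraph.mem_neighborFinset] at hw
  exact ⟨w, Finset.mem_sdiff.2 ⟨mem_nbhd.2 (Or.inr ⟨v, hv, hw.1⟩), hw.2⟩⟩

/-- The total weight on the wired graph is positive; for `t = 0` this is the existence of a spanning
tree. -/
theorem gibbs_wired_pos (hT : T.IsAcyclic) (hk : 3 ≤ k) (ht : 0 ≤ t)
    (hreg : T.IsRegularOfDegree k) (hS : (T.induce (S : Set V)).Connected) :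
    0 < gibbs T t (fun v ↦ if v ∈ S then 1 else 0) (fun v ↦ if v ∈ S then 0 else 1) (nbhd T S)
      (fun _ _ ↦ 1) := by
  obtain ⟨⟨o, ho⟩⟩ := hS.nonempty
  obtain ⟨a, b, h1, h2⟩ := exists_gibbs_marginal hT hk ht hreg hS 0 (connected_singleton o)
    (by simpa using ho)
  rw [h2 fun _ ↦ 1, gibbs_singleton]
  obtain ⟨ha, hb, -⟩ := h1 o (by simp)
  have hd : outDeg T {o} o = k := by
    rw [outDeg, Finset.sdiff_singleton_eq_erase, Finset.erase_eq_of_notMem (by simp),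
      SimpleGraph.card_neighborFinset_eq_degree, hreg.degree_eq]
  rw [hd] at hb
  have := mul_pos (add_mul_branchWeight_pos hk ht (c := (k : ℝ)) (by positivity)) ha
  linarith

/-- Along every exhaustion, the law of the edges inside a finite subtree converges to that of the
limiting model. -/
theorem tendsto_integral_finiteGas [Countable V] (hT : T.IsAcyclic) (hk : 3 ≤ k)
    (hreg : T.IsRegularOfDegree k) {β : ℝ≥0∞} (hβ : 0 < β) {S : ℕ → Finset V}
    (hS : IsExhaustion T S) (hA : (T.induce (A : Set V)).Connected) (g : Finset (Sym2 V) → ℝ) :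
    Tendsto (fun m ↦ ∫ ω, g (openIn (edgesIn T A) ω) ∂(finiteGas T β (S m : Set V))) atTop
      (𝓝 (limitGibbs T k (β⁻¹).toReal A (fun F _ ↦ g F) /
        limitGibbs T k (β⁻¹).toReal A (fun _ _ ↦ 1))) := by
  set t := (β⁻¹).toReal with htdef
  have ht : 0 ≤ t := ENNReal.toReal_nonneg
  obtain ⟨⟨o, ho⟩⟩ := hA.nonempty
  have hoA : Grow T {o} A := grow_of_connected hT (by simpa using ho) (connected_singleton o) hA
  let Φ : (V → ℝ) → ℝ := fun r ↦ gibbs T t (fun _ ↦ 1) r A (fun F _ ↦ g F) /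
    gibbs T t (fun _ ↦ 1) r A (fun _ _ ↦ 1)
  let r₀ : V → ℝ := fun v ↦ outDeg T A v * branchWeight k t
  have hΦ : ContinuousAt Φ r₀ := (continuous_gibbs _).continuousAt.div
    (continuous_gibbs _).continuousAt (limitGibbs_one_pos hk ht hreg hoA).ne'
  refine fun U hU ↦ ?_
  change ∀ᶠ m in atTop, _ ∈ U
  -- close to the limiting weights, the expectation is in `U`
  obtain ⟨n, hn⟩ : ∃ n, ∀ r : V → ℝ,
      (∀ v ∈ A, r₀ v ≤ r v ∧ r v ≤ outDeg T A v * upperWeight k t n) →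
      (∀ v ∉ A, r v = r₀ v) → Φ r ∈ U := by
    by_contra! hcon
    choose r h1 h2 h3 using hcon
    have hr : Tendsto r atTop (𝓝 r₀) := by
      refine tendsto_pi_nhds.2 fun v ↦ ?_
      by_cases hv : v ∈ A
      · exact tendsto_of_tendsto_of_tendsto_of_le_of_le tendsto_const_nhds
          ((tendsto_upperWeight hk ht).const_mul _) (fun n ↦ (h1 n v hv).1)
          (fun n ↦ (h1 n v hv).2)
      · simp only [h2 _ v hv]
        exact tendsto_const_nhds
    obtain ⟨n, hn⟩ := ((hΦ.tendsto.comp hr).eventually hU).exists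
    exact h3 n hn
  have hmem : ∀ X : Finset V, ∀ᶠ m in atTop, X ⊆ S m := by
    intro X
    have : ∀ v ∈ X, ∀ᶠ m in atTop, v ∈ S m := fun v _ ↦ by
      obtain ⟨m₀, hm₀⟩ := hS.exhausts v
      exact eventually_atTop.2 ⟨m₀, fun m hm ↦ hS.monotone hm hm₀⟩
    exact (Filter.eventually_all_finset X).2 this
  filter_upwards [hmem ((nbhd T)^[n] A), hmem A, hmem {o}] with m hm hmA hmo
  have hSm := hS.connected m
  have hoS : Grow T {o} (S m) := grow_of_connected hT hmo (connected_singleton o) hSm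
  obtain ⟨a, b, h1, h2⟩ := exists_gibbs_marginal hT hk ht hreg hSm n hA hm
  rw [integral_finiteGas hT hSm (hoS.trans (grow_nbhd hT hSm))
    (boundary_nonempty hk hreg hoS) hβ (hmA.trans subset_nbhd), h2 g, h2 fun _ ↦ 1,
    gibbs_normalize (fun v hv ↦ (h1 v hv).1), gibbs_normalize (fun v hv ↦ (h1 v hv).1),
    mul_div_mul_left _ _ (Finset.prod_pos fun v hv ↦ (h1 v hv).1).ne']
  convert hn (fun v ↦ if v ∈ A then b v / a v else r₀ v) ?_ ?_ using 1
  · congr 1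
    · rw [gibbs_congr (g := fun F _ ↦ g F) fun F hF P _ ↦ by rw [Finset.inter_eq_left.2 hF]]
      exact gibbs_congr_weights (fun _ _ ↦ rfl) (fun v hv ↦ by simp [hv]) _
    · exact gibbs_congr_weights (fun _ _ ↦ rfl) (fun v hv ↦ by simp [hv]) _
  · intro v hv
    obtain ⟨h3, h4, h5⟩ := h1 v hv
    simp only [hv, if_true]
    exact ⟨(le_div_iff₀ h3).2 h4, (div_le_iff₀ h3).2 h5⟩
  · intro v hv
    simp [hv]

end Convergence

/-! ### Stochastic domination on product spaces -/

section Domination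

variable {ι : Type*}

open Classical in
/-- The configuration that agrees with `ω` on `J` and is open outside `J`. -/
noncomputable def fill (J : Finset ι) (ω : ι → Bool) (i : ι) : Bool := if i ∈ J then ω i else true

theorem fill_mono (J : Finset ι) : Monotone (fill J) := by
  intro ω ω' h i
  unfold fill
  split_ifs
  exacts [h i, le_rfl]

theorem fill_anti {J J' : Finset ι} (h : J ⊆ J') (ω : ι → Bool) : fill J' ω ≤ fill J ω := by
  intro i
  unfold fill
  by_cases hi : i ∈ J
  · simp [hi, h hi]
  · simp [hi, Bool.le_true]

theorem le_fill (J : Finset ι) (ω : ι → Bool) : ω ≤ fill J ω := by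
  intro i
  unfold fill
  split_ifs
  exacts [le_rfl, Bool.le_true _]

theorem continuous_fill (J : Finset ι) : Continuous (fill J) := by
  refine continuous_pi fun i ↦ ?_
  unfold fill
  split_ifs
  exacts [continuous_apply i, continuous_const]

theorem finite_range_fill (J : Finset ι) : (Set.range (fill J)).Finite := by
  classical
  have h : Set.range (fill J) ⊆
      Set.range fun (c : J → Bool) (i : ι) ↦ if h : i ∈ J then c ⟨i, h⟩ else true := by
    rintro _ ⟨ω, rfl⟩
    refine ⟨fun i ↦ ω i, ?_⟩
    funext i
    by_cases hi : i ∈ J <;> simp [fill, hi]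
  exact (Set.finite_range _).subset h

theorem tendsto_fill (ω : ι → Bool) : Tendsto (fun J ↦ fill J ω) atTop (𝓝 ω) := by
  refine tendsto_pi_nhds.2 fun i ↦ ?_
  refine tendsto_const_nhds.congr' ?_
  filter_upwards [eventually_ge_atTop {i}] with J hJ
  have : i ∈ J := hJ (Finset.mem_singleton_self i)
  simp [fill, this]

variable [Countable ι]

theorem measurableSet_fill (J : Finset ι) (U : Set (ι → Bool)) :
    MeasurableSet {ω | fill J ω ∈ U} := by
  have : {ω | fill J ω ∈ U} = fill J ⁻¹' (U ∩ Set.range (fill J)) := by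
    ext ω
    simp
  rw [this]
  exact (continuous_fill J).measurable
    (((finite_range_fill J).subset Set.inter_subset_right).measurableSet)

/-- It suffices to compare increasing events that depend on finitely many coordinates. A measurable
increasing event is approximated from inside by a compact set, and the upper closure of a compact
set is a decreasing limit of increasing events that depend on finitely many coordinates. -/
theorem stochasticallyDominated_of_fill {μ ν : Measure (ι → Bool)} [IsFiniteMeasure μ]
    [IsFiniteMeasure ν]
    (h : ∀ (J : Finset ι) (U : Set (ι → Bool)), IsUpperSet U →
      μ {ω | fill J ω ∈ U} ≤ ν {ω | fill J ω ∈ U}) :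
    StochasticallyDominated μ ν := by
  intro A hA hup
  by_contra! hlt
  obtain ⟨K, hKA, hK, hμK⟩ := hA.exists_lt_isClosed_of_ne_top (measure_ne_top μ A) hlt
  let U : Set (ι → Bool) := {ω | ∃ κ ∈ K, κ ≤ ω}
  have hU : IsUpperSet U := fun ω ω' hle ⟨κ, hκ, hκω⟩ ↦ ⟨κ, hκ, hκω.trans hle⟩
  have hUA : U ⊆ A := fun ω ⟨κ, hκ, hκω⟩ ↦ hup hκω (hKA hκ)
  have hUclosed : IsClosed U := by
    have h0 : IsClosed {p : (ι → Bool) × (ι → Bool) | p.1 ≤ p.2} := by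
      simp only [Pi.le_def, Set.ofPred_forall]
      refine isClosed_iInter fun i ↦ ?_
      have hc : Continuous fun p : (ι → Bool) × (ι → Bool) ↦ (p.1 i, p.2 i) := by fun_prop
      exact (isClosed_discrete {q : Bool × Bool | q.1 ≤ q.2}).preimage hc
    have h1 : IsClosed {p : (ι → Bool) × (ι → Bool) | p.1 ∈ K ∧ p.1 ≤ p.2} :=
      (hK.preimage continuous_fst).inter h0
    have h2 : U = Prod.snd '' {p : (ι → Bool) × (ι → Bool) | p.1 ∈ K ∧ p.1 ≤ p.2} := by
      ext ω
      simp [U]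
    rw [h2]
    exact (h1.isCompact.image continuous_snd).isClosed
  have hinter : ⋂ J, {ω | fill J ω ∈ U} ⊆ U := fun ω hω ↦
    hUclosed.mem_of_tendsto (tendsto_fill ω) (Eventually.of_forall fun J ↦ Set.mem_iInter.1 hω J)
  have hlim : Tendsto (fun J ↦ ν {ω | fill J ω ∈ U}) atTop
      (𝓝 (ν (⋂ J, {ω | fill J ω ∈ U}))) :=
    tendsto_measure_iInter_atTop (fun J ↦ (measurableSet_fill J U).nullMeasurableSet)
      (fun J J' hJ ω hω ↦ hU (fill_anti hJ ω) hω) ⟨∅, measure_ne_top _ _⟩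
  have hle : μ K ≤ ν (⋂ J, {ω | fill J ω ∈ U}) :=
    ge_of_tendsto hlim (Eventually.of_forall fun J ↦ (measure_mono fun ω hω ↦
      (⟨ω, hω, le_fill J ω⟩ : fill J ω ∈ U)).trans (h J U hU))
  exact (hμK.trans_le (hle.trans (measure_mono (hinter.trans hUA)))).false

end Domination

/-! ### The wired gas on the regular tree -/

section Main

variable {V : Type*} [DecidableEq V] {T : SimpleGraph V} [T.LocallyFinite] {k : ℕ}
  {A : Finset V}

/-- The balls around a vertex are an exhaustion of a locally finite tree. -/
theorem isExhaustion_ball (hT : T.IsTree) (o : V) :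
    IsExhaustion T fun n ↦ (nbhd T)^[n] {o} := by
  refine ⟨monotone_nat_of_le_succ fun n ↦ ?_, fun n ↦ ?_, fun v ↦ ?_⟩
  · rw [Function.iterate_succ_apply']
    exact subset_nbhd
  · induction n with
    | zero => exact connected_singleton o
    | succ n ih =>
      rw [Function.iterate_succ_apply']
      exact (grow_nbhd hT.isAcyclic ih).connected ih
  · have h := (SimpleGraph.reachable_iff_reflTransGen o v).1 (hT.connected.preconnected o v)
    induction h with
    | refl => exact ⟨0, by simp⟩
    | tail _ hbc ih =>
      obtain ⟨n, hn⟩ := ih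
      refine ⟨n + 1, ?_⟩
      rw [Function.iterate_succ_apply']
      exact mem_nbhd.2 (Or.inr ⟨_, hn, hbc⟩)

theorem countable_of_isTree (hT : T.IsTree) : Countable V := by
  obtain ⟨o⟩ := hT.connected.nonempty
  rw [← Set.countable_univ_iff]
  have : (Set.univ : Set V) = ⋃ n, ((nbhd T)^[n] {o} : Finset V) :=
    (Set.eq_univ_of_forall fun v ↦ Set.mem_iUnion.2 ((isExhaustion_ball hT o).exhausts v)).symm
  rw [this]
  exact Set.countable_iUnion fun n ↦ Finset.countable_toSet _

theorem exists_connected_superset (hT : T.IsTree) (X : Finset V) (J : Finset (Sym2 V))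
    (hJ : ∀ e ∈ J, e ∈ T.edgeSet) :
    ∃ A : Finset V, (T.induce (A : Set V)).Connected ∧ X ⊆ A ∧ J ⊆ edgesIn T A := by
  obtain ⟨o⟩ := hT.connected.nonempty
  have hS := isExhaustion_ball hT o
  have hmem : ∀ v, ∀ᶠ n in atTop, v ∈ (nbhd T)^[n] {o} := fun v ↦ by
    obtain ⟨n, hn⟩ := hS.exhausts v
    exact eventually_atTop.2 ⟨n, fun m hm ↦ hS.monotone hm hn⟩
  have h1 : ∀ᶠ n in atTop, ∀ v ∈ X, v ∈ (nbhd T)^[n] {o} :=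
    (Filter.eventually_all_finset X).2 fun v _ ↦ hmem v
  have h2 : ∀ᶠ n in atTop, ∀ e ∈ J, e ∈ edgesIn T ((nbhd T)^[n] {o}) := by
    refine (Filter.eventually_all_finset J).2 fun e he ↦ ?_
    have := hJ e he
    induction e with
    | h x y =>
      filter_upwards [hmem x, hmem y] with n hx hy
      exact mem_edgesIn.2 ⟨hx, hy, this⟩
  obtain ⟨n, h1, h2⟩ := (h1.and h2).exists
  exact ⟨_, hS.connected n, h1, h2⟩

omit [DecidableEq V] [T.LocallyFinite] in
theorem mem_openIn {J : Finset (Sym2 V)} {e : T.edgeSet} (he : (e : Sym2 V) ∈ J) {ω : Config T} :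
    (e : Sym2 V) ∈ openIn J ω ↔ ω e = true := by
  unfold openIn
  rw [Finset.mem_filter]
  simp [he, extendConfig]

omit [T.LocallyFinite] in
theorem measurableSet_openIn [Countable V] (J : Finset (Sym2 V)) (Q : Finset (Sym2 V) → Prop) :
    MeasurableSet {ω : Config T | Q (openIn J ω)} := by
  classical
  have := (continuous_openIn (T := T) J fun F ↦ decide (Q F)).measurable
    (measurableSet_singleton true)
  simpa [Set.preimage] using this

open Classical in
/-- The indicator of a proposition, as a real number. -/
noncomputable def ind (p : Prop) : ℝ := if p then 1 else 0

omit [DecidableEq V] [T.LocallyFinite] in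
@[simp] theorem ind_true : ind True = 1 := if_pos trivial

omit [DecidableEq V] [T.LocallyFinite] in
@[simp] theorem ind_false : ind False = 0 := if_neg not_false

omit [DecidableEq V] [T.LocallyFinite] in
theorem ind_and (p q : Prop) : ind (p ∧ q) = ind p * ind q := by
  by_cases hp : p <;> by_cases hq : q <;> simp [hp, hq]

omit [DecidableEq V] [T.LocallyFinite] in
theorem ind_nonneg (p : Prop) : 0 ≤ ind p := by
  by_cases hp : p <;> simp [hp]

omit [T.LocallyFinite] in
theorem integral_openIn [Countable V] (μ : Measure (Config T)) (J : Finset (Sym2 V))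
    (Q : Finset (Sym2 V) → Prop) :
    ∫ ω, ind (Q (openIn J ω)) ∂μ = μ.real {ω | Q (openIn J ω)} := by
  have := integral_indicator_one (μ := μ) (measurableSet_openIn (T := T) J Q)
  rw [← this]
  refine integral_congr_ae (Eventually.of_forall fun ω ↦ ?_)
  by_cases h : Q (openIn J ω)
  · rw [Set.indicator_of_mem (show ω ∈ {ω | Q (openIn J ω)} from h)]
    simp [h]
  · rw [Set.indicator_of_notMem (show ω ∉ {ω | Q (openIn J ω)} from h)]
    simp [h]

/-- The expectation of `g` under the limiting model on `A`. -/
noncomputable def limitMean (T : SimpleGraph V) [T.LocallyFinite] (k : ℕ) (t : ℝ) (A : Finset V)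
    (g : Finset (Sym2 V) → ℝ) : ℝ :=
  limitGibbs T k t A (fun F _ ↦ g F) / limitGibbs T k t A (fun _ _ ↦ 1)

/-- The finite-dimensional marginals of a wired gas. -/
theorem IsWiredGas.integral_openIn [Countable V] (hT : T.IsTree) (hk : 3 ≤ k)
    (hreg : T.IsRegularOfDegree k) {β : ℝ≥0∞} (hβ : 0 < β) {μ : Measure (Config T)}
    (hμ : IsWiredGas T β μ) (hA : (T.induce (A : Set V)).Connected) (g : Finset (Sym2 V) → ℝ) :
    ∫ ω, g (openIn (edgesIn T A) ω) ∂μ = limitMean T k (β⁻¹).toReal A g := by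
  obtain ⟨o⟩ := hT.connected.nonempty
  have hS := isExhaustion_ball hT o
  exact tendsto_nhds_unique
    (hμ.tendsto _ hS (BoundedContinuousFunction.mkOfCompact ⟨_, continuous_openIn _ g⟩))
    (tendsto_integral_finiteGas hT.isAcyclic hk hreg hβ hS hA g)

theorem IsWiredGas.real_openIn [Countable V] (hT : T.IsTree) (hk : 3 ≤ k)
    (hreg : T.IsRegularOfDegree k) {β : ℝ≥0∞} (hβ : 0 < β) {μ : Measure (Config T)}
    (hμ : IsWiredGas T β μ) (hA : (T.induce (A : Set V)).Connected)
    (Q : Finset (Sym2 V) → Prop) :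
    μ.real {ω | Q (openIn (edgesIn T A) ω)} =
      limitMean T k (β⁻¹).toReal A fun F ↦ ind (Q F) := by
  rw [← hμ.integral_openIn hT hk hreg hβ hA, WiredGas.integral_openIn]

/-- A measure is determined by its marginals on finite subtrees. -/
theorem ext_of_integral_openIn [Countable V] (hT : T.IsTree) {μ ν : Measure (Config T)}
    [IsFiniteMeasure μ] [IsFiniteMeasure ν]
    (h : ∀ A : Finset V, (T.induce (A : Set V)).Connected → ∀ g : Finset (Sym2 V) → ℝ,
      ∫ ω, g (openIn (edgesIn T A) ω) ∂μ = ∫ ω, g (openIn (edgesIn T A) ω) ∂ν) : μ = ν := by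
  classical
  refine IsProjectiveLimit.unique (P := fun I ↦ ν.map I.restrict) (fun I ↦ ?_) fun I ↦ rfl
  obtain ⟨A, hA, -, hIA⟩ := exists_connected_superset hT ∅ (I.map ⟨Subtype.val, Subtype.val_injective⟩)
    (by simp +contextual)
  have hI : ∀ i : I, ((i : T.edgeSet) : Sym2 V) ∈ edgesIn T A := fun i ↦
    hIA (Finset.mem_map_of_mem _ i.2)
  refine Measure.ext_of_singleton fun c ↦ ?_
  have hm : Measurable (I.restrict : Config T → _) := Finset.measurable_restrict I
  rw [Measure.map_apply hm (measurableSet_singleton c),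
    Measure.map_apply hm (measurableSet_singleton c)]
  have hset : (I.restrict ⁻¹' {c} : Set (Config T)) =
      {ω | ∀ i : I, ((i : T.edgeSet) : Sym2 V) ∈ openIn (edgesIn T A) ω ↔ c i = true} := by
    ext ω
    simp only [Set.mem_preimage, Set.mem_singleton_iff, Set.mem_ofPred_eq, funext_iff]
    refine forall_congr' fun i ↦ ?_
    rw [mem_openIn (hI i), ← Bool.eq_iff_iff]
    rfl
  have := h A hA fun F ↦ ind (∀ i : I, ((i : T.edgeSet) : Sym2 V) ∈ F ↔ c i = true)
  rw [integral_openIn μ _ fun F ↦ ∀ i : I, ((i : T.edgeSet) : Sym2 V) ∈ F ↔ c i = true,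
    integral_openIn ν _ fun F ↦ ∀ i : I, ((i : T.edgeSet) : Sym2 V) ∈ F ↔ c i = true] at this
  rw [hset, ← measureReal_eq_measureReal_iff]
  exact this

/-- Existence and uniqueness. The probability measures on the configurations form a compact space, and
all limit points along all exhaustions have the marginals of the limiting model. -/
theorem existsUnique_isWiredGas [Countable V] (hT : T.IsTree) (hk : 3 ≤ k)
    (hreg : T.IsRegularOfDegree k) {β : ℝ≥0∞} (hβ : 0 < β) :
    ∃! μ : Measure (Config T), IsWiredGas T β μ := by
  have ht : 0 ≤ (β⁻¹).toReal := ENNReal.toReal_nonneg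
  have hprob : ∀ S : Finset V, (T.induce (S : Set V)).Connected →
      IsProbabilityMeasure (finiteGas T β (S : Set V)) := by
    intro S hS
    obtain ⟨⟨o, ho⟩⟩ := hS.nonempty
    have hg := grow_of_connected hT.isAcyclic (by simpa using ho) (connected_singleton o) hS
    exact isProbabilityMeasure_finiteGas hT.isAcyclic hS
      (hg.trans (grow_nbhd hT.isAcyclic hS)) (boundary_nonempty hk hreg hg) hβ
      (gibbs_wired_pos hT.isAcyclic hk ht hreg hS).ne'
  -- the gas along an exhaustion, as a sequence in the compact space of probability measures
  let P : (S : ℕ → Finset V) → IsExhaustion T S → ℕ → ProbabilityMeasure (Config T) :=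
    fun S hS n ↦ ⟨finiteGas T β (S n : Set V), hprob _ (hS.connected n)⟩
  have hP : ∀ S hS (U : Ultrafilter ℕ) (ν : ProbabilityMeasure (Config T)), (U : Filter ℕ) ≤ atTop →
      Tendsto (P S hS) (U : Filter ℕ) (𝓝 ν) → ∀ A : Finset V, (T.induce (A : Set V)).Connected →
      ∀ g : Finset (Sym2 V) → ℝ, ∫ ω, g (openIn (edgesIn T A) ω) ∂(ν : Measure (Config T)) =
        limitMean T k (β⁻¹).toReal A g := by
    intro S hS U ν hU hν A hA g
    exact tendsto_nhds_unique
      (ProbabilityMeasure.tendsto_iff_forall_integral_tendsto.1 hν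
        (BoundedContinuousFunction.mkOfCompact ⟨_, continuous_openIn _ g⟩))
      ((tendsto_integral_finiteGas hT.isAcyclic hk hreg hβ hS hA g).mono_left hU)
  have hlim : ∀ S hS (U : Ultrafilter ℕ), ∃ ν, Tendsto (P S hS) (U : Filter ℕ) (𝓝 ν) := fun S hS U ↦
    ⟨_, (U.map (P S hS)).le_nhds_lim⟩
  obtain ⟨o⟩ := hT.connected.nonempty
  have hball := isExhaustion_ball hT o
  obtain ⟨μ, hμ⟩ := hlim _ hball (hyperfilter ℕ)
  have hμ' := hP _ hball _ μ Nat.hyperfilter_le_atTop hμ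
  -- all limit points along all exhaustions have the same marginals
  have htends : ∀ S hS, Tendsto (P S hS) atTop (𝓝 μ) := by
    intro S hS
    rw [tendsto_iff_ultrafilter]
    intro U hU
    obtain ⟨ν, hν⟩ := hlim S hS U
    have hν' := hP S hS U ν hU hν
    have : (μ : Measure (Config T)) = ν :=
      ext_of_integral_openIn hT fun A hA g ↦ (hμ' A hA g).trans (hν' A hA g).symm
    rwa [Subtype.ext this]
  refine ⟨μ, ⟨μ.2, fun S hS f ↦
    ProbabilityMeasure.tendsto_iff_forall_integral_tendsto.1 (htends S hS) f⟩, fun ν hν ↦ ?_⟩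
  have := hν.isProbabilityMeasure
  exact ext_of_integral_openIn hT fun A hA g ↦
    (hν.integral_openIn hT hk hreg hβ hA g).trans (hμ' A hA g).symm

omit [DecidableEq V] [T.LocallyFinite] in
theorem ind_le_ind {p q : Prop} (h : p → q) : ind p ≤ ind q := by
  by_cases hp : p
  · simp [hp, h hp]
  · by_cases hq : q <;> simp [hp, hq]

open Classical in
theorem increasing_of_isUpperSet {ι : Type*} (J : Finset ι) (φ : ι → Sym2 V) {U : Set (ι → Bool)}
    (hU : IsUpperSet U) :
    Increasing fun F (_ : Finset V) ↦
      ind (fill J (fun i ↦ decide (φ i ∈ F)) ∈ U) := by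
  intro F F' _ _ hF _
  have hle : fill J (fun i ↦ decide (φ i ∈ F)) ≤ fill J fun i ↦ decide (φ i ∈ F') :=
    fill_mono J fun i ↦ by
      rw [Bool.le_iff_imp]
      simpa using fun h ↦ hF h
  exact ind_le_ind fun h ↦ hU hle h

omit [DecidableEq V] [T.LocallyFinite] in
theorem fill_congr {ι : Type*} {J : Finset ι} {ω ω' : ι → Bool} (h : ∀ i ∈ J, ω i = ω' i) :
    fill J ω = fill J ω' := by
  funext i
  by_cases hi : i ∈ J
  · simp [fill, hi, h i hi]
  · simp [fill, hi]

theorem IsWiredGas.stochasticallyDominated [Countable V] (hT : T.IsTree) (hk : 3 ≤ k)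
    (hreg : T.IsRegularOfDegree k) {β₁ β₂ : ℝ≥0∞} (hβ : 0 < β₁) (hββ : β₁ ≤ β₂)
    {μ₁ μ₂ : Measure (Config T)} (h₁ : IsWiredGas T β₁ μ₁) (h₂ : IsWiredGas T β₂ μ₂) :
    StochasticallyDominated μ₁ μ₂ := by
  classical
  have := h₁.isProbabilityMeasure
  have := h₂.isProbabilityMeasure
  refine stochasticallyDominated_of_fill fun J U hU ↦ ?_
  obtain ⟨A, hA, -, hJA⟩ := exists_connected_superset hT ∅
    (J.map ⟨Subtype.val, Subtype.val_injective⟩) (by simp +contextual)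
  have hset : {ω : Config T | fill J ω ∈ U} = {ω | fill J (fun i : T.edgeSet ↦
      decide ((i : Sym2 V) ∈ openIn (edgesIn T A) ω)) ∈ U} := by
    ext ω
    have : fill J ω = fill J fun i : T.edgeSet ↦
        decide ((i : Sym2 V) ∈ openIn (edgesIn T A) ω) := by
      refine fill_congr fun i hi ↦ ?_
      rw [Bool.eq_iff_iff, decide_eq_true_iff, mem_openIn (hJA (Finset.mem_map_of_mem _ hi))]
    rw [Set.mem_ofPred_eq, Set.mem_ofPred_eq, this]
  obtain ⟨⟨o, ho⟩⟩ := hA.nonempty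
  have hg := grow_of_connected hT.isAcyclic (by simpa using ho) (connected_singleton o) hA
  have hβ₁ : β₁⁻¹ ≠ ∞ := ENNReal.inv_ne_top.2 hβ.ne'
  rw [hset, ← ENNReal.toReal_le_toReal (measure_ne_top _ _) (measure_ne_top _ _)]
  have e1 := h₁.real_openIn hT hk hreg hβ hA fun F ↦
    fill J (fun i : T.edgeSet ↦ decide ((i : Sym2 V) ∈ F)) ∈ U
  have e2 := h₂.real_openIn hT hk hreg (hβ.trans_le hββ) hA fun F ↦
    fill J (fun i : T.edgeSet ↦ decide ((i : Sym2 V) ∈ F)) ∈ U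
  rw [measureReal_def] at e1 e2
  rw [e1, e2]
  exact limitGibbs_mono hk hreg ENNReal.toReal_nonneg
    (ENNReal.toReal_mono hβ₁ (ENNReal.inv_le_inv.2 hββ)) hg (increasing_of_isUpperSet J _ hU)

theorem IsWiredGas.edge_ne_zero [Countable V] (hT : T.IsTree) (hk : 3 ≤ k)
    (hreg : T.IsRegularOfDegree k) {β : ℝ≥0∞} (hβ : 0 < β) {μ : Measure (Config T)}
    (hμ : IsWiredGas T β μ) (e : T.edgeSet) :
    μ {ω | ω e = true} ≠ 0 ∧ μ {ω | ω e = false} ≠ 0 := by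
  classical
  have := hμ.isProbabilityMeasure
  obtain ⟨e, he⟩ := e
  induction e with
  | h x y =>
    have hxy : T.Adj x y := he
    have hA := connected_pair hxy
    have hmem : s(x, y) ∈ edgesIn T {x, y} := mem_edgesIn.2 ⟨by simp, by simp, hxy⟩
    have key : ∀ Q : Prop → Prop, 0 < ind (Q True) + ind (Q False) →
        μ {ω : Config T | Q (s(x, y) ∈ openIn (edgesIn T {x, y}) ω)} ≠ 0 := by
      intro Q hQ h0
      have e1 := hμ.real_openIn hT hk hreg hβ hA fun F ↦ Q (s(x, y) ∈ F)
      rw [measureReal_def, h0, ENNReal.toReal_zero] at e1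
      have ht : 0 ≤ (β⁻¹).toReal := ENNReal.toReal_nonneg
      have p1 := limitGibbs_edge_pos hk hreg ht hxy Grow.refl
        (fun p ↦ ind (Q p)) (ind_nonneg _) (ind_nonneg _) hQ
      have p2 := limitGibbs_one_pos hk ht hreg (grow_pair hxy)
      simp only [one_mul] at p1
      exact (div_pos p1 p2).ne e1
    constructor
    · have := key (fun p ↦ p) (by simp)
      convert this using 4 with ω
      exact (mem_openIn (e := ⟨s(x, y), he⟩) hmem).symm
    · have := key (fun p ↦ ¬ p) (by simp)
      convert this using 4 with ω
      rw [mem_openIn (e := ⟨s(x, y), he⟩) hmem, Bool.not_eq_true]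

theorem IsWiredGas.negative_dependence [Countable V] (hT : T.IsTree) (hk : 3 ≤ k)
    (hreg : T.IsRegularOfDegree k) {β : ℝ≥0∞} (hβ : 0 < β) {μ : Measure (Config T)}
    (hμ : IsWiredGas T β μ) (e : T.edgeSet) :
    StochasticallyDominated ((μ[|{ω | ω e = true}]).map (forget T e))
      ((μ[|{ω | ω e = false}]).map (forget T e)) := by
  classical
  have := hμ.isProbabilityMeasure
  obtain ⟨e, he⟩ := e
  induction e with
  | h x y =>
    have hxy : T.Adj x y := he
    have hforget : Measurable (forget T ⟨s(x, y), he⟩) :=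
      measurable_pi_lambda _ fun f ↦ measurable_pi_apply _
    refine stochasticallyDominated_of_fill fun J U hU ↦ ?_
    obtain ⟨A, hA, hxyA, hJA⟩ := exists_connected_superset hT {x, y}
      (J.map ⟨fun f : {f : T.edgeSet // f ≠ ⟨s(x, y), he⟩} ↦ ((f : T.edgeSet) : Sym2 V),
        Subtype.coe_injective.comp Subtype.coe_injective⟩)
      (fun e h ↦ by obtain ⟨f, -, rfl⟩ := Finset.mem_map.1 h; exact f.1.2)
    have hmem : s(x, y) ∈ edgesIn T A :=
      mem_edgesIn.2 ⟨hxyA (by simp), hxyA (by simp), hxy⟩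
    have hg : Grow T {x, y} A := grow_of_connected hT.isAcyclic hxyA (connected_pair hxy) hA
    let Q : Finset (Sym2 V) → Prop := fun F ↦ fill J
      (fun f : {f : T.edgeSet // f ≠ ⟨s(x, y), he⟩} ↦ decide (((f : T.edgeSet) : Sym2 V) ∈ F)) ∈ U
    have hQ : ∀ ω : Config T, fill J (forget T ⟨s(x, y), he⟩ ω) ∈ U ↔
        Q (openIn (edgesIn T A) ω) := by
      intro ω
      have : fill J (forget T ⟨s(x, y), he⟩ ω) = fill J fun f ↦
          decide (((f : T.edgeSet) : Sym2 V) ∈ openIn (edgesIn T A) ω) := by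
        refine fill_congr fun f hf ↦ ?_
        rw [Bool.eq_iff_iff, decide_eq_true_iff, mem_openIn (hJA (Finset.mem_map_of_mem _ hf))]
        rfl
      rw [this]
    -- conditional probabilities are quotients of expectations in the limiting model
    have hcond : ∀ (b : Bool) (φ : Prop → Prop), (∀ p, φ p ↔ (p ↔ b = true)) →
        ((μ[|{ω | ω ⟨s(x, y), he⟩ = b}]).map (forget T ⟨s(x, y), he⟩)) {ω | fill J ω ∈ U} =
        ENNReal.ofReal (limitGibbs T k (β⁻¹).toReal A (fun F _ ↦ ind (Q F) * ind (φ (s(x, y) ∈ F))) /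
          limitGibbs T k (β⁻¹).toReal A
            (fun F _ ↦ 1 * ind (φ (s(x, y) ∈ F)))) := by
      intro b φ hφ
      have hs : {ω : Config T | ω ⟨s(x, y), he⟩ = b} =
          {ω | φ (s(x, y) ∈ openIn (edgesIn T A) ω)} := by
        ext ω
        rw [Set.mem_ofPred_eq, Set.mem_ofPred_eq, hφ,
          mem_openIn (e := ⟨s(x, y), he⟩) hmem, Bool.eq_iff_iff]
      have hms : MeasurableSet {ω : Config T | ω ⟨s(x, y), he⟩ = b} := by
        rw [hs]
        exact measurableSet_openIn _ fun F ↦ φ (s(x, y) ∈ F)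
      have hinter : {ω : Config T | ω ⟨s(x, y), he⟩ = b} ∩
          forget T ⟨s(x, y), he⟩ ⁻¹' {ω | fill J ω ∈ U} =
          {ω | Q (openIn (edgesIn T A) ω) ∧ φ (s(x, y) ∈ openIn (edgesIn T A) ω)} := by
        rw [hs]
        ext ω
        simp only [Set.mem_inter_iff, Set.mem_preimage, Set.mem_ofPred_eq, hQ]
        exact and_comm
      have e1 := hμ.real_openIn hT hk hreg hβ hA fun F ↦ Q F ∧ φ (s(x, y) ∈ F)
      have e2 := hμ.real_openIn hT hk hreg hβ hA fun F ↦ φ (s(x, y) ∈ F)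
      have hZ := limitGibbs_one_pos hk (ENNReal.toReal_nonneg (a := β⁻¹)) hreg
        ((grow_pair hxy).trans hg)
      rw [← ENNReal.ofReal_toReal (measure_ne_top _ {ω | fill J ω ∈ U}),
        Measure.map_apply hforget (measurableSet_fill J U), cond_apply hms, hinter, hs,
        ENNReal.toReal_mul, ENNReal.toReal_inv, ← measureReal_def, ← measureReal_def, e1, e2,
        limitMean, limitMean, inv_mul_eq_div, div_div_div_cancel_right₀ hZ.ne']
      simp only [ind_and, one_mul]
    rw [hcond true (fun p ↦ p) (by simp), hcond false (fun p ↦ ¬ p) (by simp)]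
    refine ENNReal.ofReal_le_ofReal ?_
    have ht : 0 ≤ (β⁻¹).toReal := ENNReal.toReal_nonneg
    have p1 := limitGibbs_edge_pos hk hreg ht hxy hg ind
      (by simp) (by simp) (by simp)
    have p2 := limitGibbs_edge_pos hk hreg ht hxy hg (fun p ↦ ind ¬ p)
      (by simp) (by simp) (by simp)
    rw [div_le_div_iff₀ p1 p2]
    refine limitGibbs_negative_dependence hk hreg ht hxy hg
      (f := fun F _ ↦ ind (Q F)) (φ := ind) (ψ := fun p ↦ ind ¬ p) (increasing_of_isUpperSet J _ hU) ?_ (by simp)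
      (by simp) (by simp) (by simp)
    intro F _
    have : Q (insert s(x, y) F) ↔ Q F := by
      have : ∀ f : {f : T.edgeSet // f ≠ ⟨s(x, y), he⟩}, ((f : T.edgeSet) : Sym2 V) ≠ s(x, y) :=
        fun f h ↦ f.2 (Subtype.ext h)
      simp [Q, this]
    simp only [this]

end Main

end WiredGas

theorem mainTheorem2 {V : Type*} (T : SimpleGraph V) [T.LocallyFinite] (hT : T.IsTree)
    (k : ℕ) (hk : 3 ≤ k) (hreg : T.IsRegularOfDegree k) :
    -- the wired arboreal gas is well defined for every parameter in `(0, ∞]`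
    (∀ β : ℝ≥0∞, 0 < β → ∃! μ : Measure (WiredGas.Config T), WiredGas.IsWiredGas T β μ) ∧
    -- monotonicity in the parameter
    (∀ (β₁ β₂ : ℝ≥0∞) (μ₁ μ₂ : Measure (WiredGas.Config T)), 0 < β₁ → β₁ < β₂ →
      WiredGas.IsWiredGas T β₁ μ₁ → WiredGas.IsWiredGas T β₂ μ₂ →
      WiredGas.StochasticallyDominated μ₁ μ₂) ∧
    -- negative dependence
    (∀ (β : ℝ≥0∞) (μ : Measure (WiredGas.Config T)) (e : T.edgeSet), 0 < β →
      WiredGas.IsWiredGas T β μ →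
      μ {ω | ω e = true} ≠ 0 ∧ μ {ω | ω e = false} ≠ 0 ∧
      WiredGas.StochasticallyDominated
        ((μ[|{ω | ω e = true}]).map (WiredGas.forget T e))
        ((μ[|{ω | ω e = false}]).map (WiredGas.forget T e))) := by
  classical
  have := WiredGas.countable_of_isTree hT
  refine ⟨fun β hβ ↦ WiredGas.existsUnique_isWiredGas hT hk hreg hβ,
    fun β₁ β₂ μ₁ μ₂ hβ hββ h₁ h₂ ↦ h₁.stochasticallyDominated hT hk hreg hβ hββ.le h₂,
    fun β μ e hβ hμ ↦ ?_⟩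
  obtain ⟨h1, h2⟩ := hμ.edge_ne_zero hT hk hreg hβ e
  exact ⟨h1, h2, hμ.negative_dependence hT hk hreg hβ e⟩
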